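/- Let $d\ge 1$ be an integer and let $\mathbb L=\mathbb C(u,v,z)$ be the field of rational functions in three indeterminates. For $n\ge 1$ let $Y_n=Y^{B}_{d,n}$ be the unital associative $\mathbb L$-algebra generated by $b_1$, $g_1,\dots,g_{n-1}$, $t_1,\dots,t_n$ subject to $$g_ig_j=g_jg_i\ (|i-j|>1),\qquad g_ig_jg_i=g_jg_ig_j\ (|i-j|=1),\qquad b_1g_i=g_ib_1\ (i\ne1),\qquad b_1g_1b_1g_1=g_1b_1g_1b_1,$$ $$t_it_j=t_jt_i,\qquad t_jg_i=g_it_{s_i(j)},\qquad t_ib_1=b_1t_i,\qquad t_i^d=1,$$ $$g_i^2=1+(u-u^{-1})e_ig_i,\qquad b_1^2=1+(v-v^{-1})f_1b_1,$$ where $s_i$ is the transposition $(i,\,i+1)$, $e_i=\frac1d\sum_{m=0}^{d-1}t_i^mt_{i+1}^{d-m}$ and $f_1=\frac1d\sum_{m=0}^{d-1}t_1^m$. Put $Y_0=\mathbb L$. Elements of $Y_n$ are regarded as elements of $Y_{n+1}$ via the natural algebra homomorphism $Y_n\to Y_{n+1}$ sending each generator to the generator of the same name. The $g_i$ are invertible;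 put $b_k=g_{k-1}\cdots g_1b_1g_1^{-1}\cdots g_{k-1}^{-1}$, and for $1\le j\le k$, $0\le a\le d-1$, $$\mathfrak m^+_{k,j,a}=g_{k-1}\cdots g_jt_j^a,\qquad \mathfrak m^-_{k,j,a}=g_{k-1}\cdots g_jb_jt_j^a$$ (so $\mathfrak m^+_{k,k,a}=t_k^a$ and $\mathfrak m^-_{k,k,a}=b_kt_k^a$). Let $M_k$ be the set of all $\mathfrak m^{\pm}_{k,j,a}$ and let $C_n\subseteq Y_n$ be the set of all products $\mathfrak m_1\mathfrak m_2\cdots\mathfrak m_n$ with $\mathfrak m_k\in M_k$ (so $C_0=\{1\}$). Let $x_0=1$ and let $x_1,\dots,x_{d-1},y_0,\dots,y_{d-1}\in\mathbb L$ be arbitrary. Then: 1. For every $n\ge0$, $C_n$ is an $\mathbb L$-basis of $Y_n$. 2. There is a unique family of $\mathbb L$-linear maps $\mathrm{tr}_n:Y_n\to Y_{n-1}$ $(n\ge1)$ such that for all $w\in C_{n-1}$ and $0\le a\le d-1$, $$\mathrm{tr}_n(wt_n^a)=x_aw,\qquad \mathrm{tr}_n(wb_nt_n^a)=y_aw,\qquad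 \mathrm{tr}_n(w\,\mathfrak m^{\pm}_{n,k,a})=z\,w\,\mathfrak m^{\pm}_{n-1,k,a}\quad(1\le k\le n-1).$$ 3. The linear maps $\mathrm{Tr}_n=\mathrm{tr}_1\circ\cdots\circ\mathrm{tr}_n:Y_n\to\mathbb L$ satisfy, for all $n\ge1$, $X,X'\in Y_n$ and $0\le m\le d-1$: (i) $\mathrm{Tr}_n(1)=1$; (ii) $\mathrm{Tr}_{n+1}(Xg_n)=z\,\mathrm{Tr}_n(X)$; (iii) $\mathrm{Tr}_{n+1}(Xb_{n+1}t_{n+1}^m)=y_m\,\mathrm{Tr}_n(X)$; (iv) $\mathrm{Tr}_{n+1}(Xt_{n+1}^m)=x_m\,\mathrm{Tr}_n(X)$; (v) $\mathrm{Tr}_n(XX')=\mathrm{Tr}_n(X'X)$. That is, $(\mathrm{Tr}_n)_{n\ge1}$ is a Markov trace on the tower of algebras $(Y_n)_{n\ge 1}$. 4. $(\mathrm{Tr}_n)_{n\ge1}$ is the only family of $\mathbb L$-linear maps $Y_n\to\mathbb L$ satisfying (i)–(v) for all $n\ge1$. -/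

import Mathlib

noncomputable section

namespace FramedB

/-- The field `ℂ(u, v, z)` of rational functions in three indeterminates. -/
abbrev 𝕃 : Type := FractionRing (MvPolynomial (Fin 3) ℂ)

/-- The indeterminate `u`. -/
def pu : 𝕃 := algebraMap (MvPolynomial (Fin 3) ℂ) 𝕃 (MvPolynomial.X 0)

/-- The indeterminate `v`. -/
def pv : 𝕃 := algebraMap (MvPolynomial (Fin 3) ℂ) 𝕃 (MvPolynomial.X 1)

/-- The indeterminate `z`. -/
def pz : 𝕃 := algebraMap (MvPolynomial (Fin 3) ℂ) 𝕃 (MvPolynomial.X 2)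

/-- The generators `b₁` (present when `1 ≤ n`), `g₁, …, gₙ₋₁` and `t₁, …, tₙ`. -/
inductive Gen (n : ℕ) : Type
  | b (h : 1 ≤ n) : Gen n
  | g (i : ℕ) (h : 1 ≤ i ∧ i + 1 ≤ n) : Gen n
  | t (j : ℕ) (h : 1 ≤ j ∧ j ≤ n) : Gen n

/-- Free algebra on the generators. -/
abbrev Free (n : ℕ) : Type := FreeAlgebra 𝕃 (Gen n)

/-- `b₁` in the free algebra; an index out of range is never used and gives the value `1`. -/
def fb (n : ℕ) : Free n := if h : 1 ≤ n then FreeAlgebra.ι 𝕃 (Gen.b h) else 1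

/-- `gᵢ` in the free algebra, for `1 ≤ i ≤ n - 1`. -/
def fg (n i : ℕ) : Free n :=
  if h : 1 ≤ i ∧ i + 1 ≤ n then FreeAlgebra.ι 𝕃 (Gen.g i h) else 1

/-- `tⱼ` in the free algebra, for `1 ≤ j ≤ n`. -/
def ft (n j : ℕ) : Free n :=
  if h : 1 ≤ j ∧ j ≤ n then FreeAlgebra.ι 𝕃 (Gen.t j h) else 1

/-- `eᵢ = (1/d) ∑ₘ tᵢ^m tᵢ₊₁^(d-m)` in the free algebra. -/
def fe (d n i : ℕ) : Free n :=
  (d : 𝕃)⁻¹ • ∑ m ∈ Finset.range d, ft n i ^ m * ft n (i + 1) ^ (d - m)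

/-- `f₁ = (1/d) ∑ₘ t₁^m` in the free algebra. -/
def ff (d n : ℕ) : Free n := (d : 𝕃)⁻¹ • ∑ m ∈ Finset.range d, ft n 1 ^ m

/-- The defining relations of `Y_{d,n}^B`. The index range of each relation is made explicit, so
that only genuine generators occur. -/
inductive Rel (d n : ℕ) : Free n → Free n → Prop
  | g_comm (i j : ℕ) (hi : 1 ≤ i ∧ i + 1 ≤ n) (hj : 1 ≤ j ∧ j + 1 ≤ n)
      (hij : i + 1 < j ∨ j + 1 < i) : Rel d n (fg n i * fg n j) (fg n j * fg n i)
  | g_braid (i j : ℕ) (hi : 1 ≤ i ∧ i + 1 ≤ n) (hj : 1 ≤ j ∧ j + 1 ≤ n)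
      (hij : i + 1 = j ∨ j + 1 = i) :
      Rel d n (fg n i * fg n j * fg n i) (fg n j * fg n i * fg n j)
  | b_g_comm (i : ℕ) (hi : 1 ≤ i ∧ i + 1 ≤ n) (hi1 : i ≠ 1) :
      Rel d n (fb n * fg n i) (fg n i * fb n)
  | b_g_braid (hn : 2 ≤ n) :
      Rel d n (fb n * fg n 1 * fb n * fg n 1) (fg n 1 * fb n * fg n 1 * fb n)
  | t_comm (i j : ℕ) (hi : 1 ≤ i ∧ i ≤ n) (hj : 1 ≤ j ∧ j ≤ n) :
      Rel d n (ft n i * ft n j) (ft n j * ft n i)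
  | t_g (i j : ℕ) (hi : 1 ≤ i ∧ i + 1 ≤ n) (hj : 1 ≤ j ∧ j ≤ n) :
      Rel d n (ft n j * fg n i) (fg n i * ft n (Equiv.swap i (i + 1) j))
  | t_b (j : ℕ) (hj : 1 ≤ j ∧ j ≤ n) : Rel d n (ft n j * fb n) (fb n * ft n j)
  | t_pow (j : ℕ) (hj : 1 ≤ j ∧ j ≤ n) : Rel d n (ft n j ^ d) 1
  | g_sq (i : ℕ) (hi : 1 ≤ i ∧ i + 1 ≤ n) :
      Rel d n (fg n i ^ 2) (1 + (pu - pu⁻¹) • (fe d n i * fg n i))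
  | b_sq (hn : 1 ≤ n) : Rel d n (fb n ^ 2) (1 + (pv - pv⁻¹) • (ff d n * fb n))

/-- The algebra `Y_{d,n}^B` over `ℂ(u, v, z)`, by generators and relations. For `n = 0` there are
no generators and this is the ground field. -/
def Y (d n : ℕ) : Type := RingQuot (Rel d n)

instance (d n : ℕ) : Ring (Y d n) := inferInstanceAs (Ring (RingQuot (Rel d n)))

instance (d n : ℕ) : Algebra 𝕃 (Y d n) := inferInstanceAs (Algebra 𝕃 (RingQuot (Rel d n)))

/-- The projection of the free algebra onto `Y_{d,n}^B`. -/
def proj (d n : ℕ) : Free n →ₐ[𝕃] Y d n := RingQuot.mkAlgHom 𝕃 (Rel d n)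

/-- `b₁` in `Y_{d,n}^B`. -/
def b (d n : ℕ) : Y d n := proj d n (fb n)

/-- `gᵢ` in `Y_{d,n}^B`. -/
def g (d n i : ℕ) : Y d n := proj d n (fg n i)

/-- `tⱼ` in `Y_{d,n}^B`. -/
def t (d n j : ℕ) : Y d n := proj d n (ft n j)

/-- `eᵢ` in `Y_{d,n}^B`. -/
def e (d n i : ℕ) : Y d n :=
  (d : 𝕃)⁻¹ • ∑ m ∈ Finset.range d, t d n i ^ m * t d n (i + 1) ^ (d - m)

/-- The inverse of `gᵢ`, that is `gᵢ - (u - u⁻¹) eᵢ`. -/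
def gInv (d n i : ℕ) : Y d n := g d n i - (pu - pu⁻¹) • e d n i

theorem proj_rel {d n : ℕ} {p q : Free n} (h : Rel d n p q) : proj d n p = proj d n q :=
  RingQuot.mkAlgHom_rel 𝕃 h

theorem proj_fe (d n i : ℕ) : proj d n (fe d n i) = e d n i := by
  simp [fe, e, t, map_sum]

theorem t_mul_g (d n i j : ℕ) (hi : 1 ≤ i ∧ i + 1 ≤ n) (hj : 1 ≤ j ∧ j ≤ n) :
    t d n j * g d n i = g d n i * t d n (Equiv.swap i (i + 1) j) := by
  simpa [t, g] using proj_rel (Rel.t_g (d := d) i j hi hj)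

theorem t_pow_d (d n j : ℕ) (hj : 1 ≤ j ∧ j ≤ n) : t d n j ^ d = 1 := by
  simpa [t] using proj_rel (Rel.t_pow (d := d) j hj)

theorem t_comm (d n i j : ℕ) (hi : 1 ≤ i ∧ i ≤ n) (hj : 1 ≤ j ∧ j ≤ n) :
    Commute (t d n i) (t d n j) := by
  simpa [t, Commute, SemiconjBy] using proj_rel (Rel.t_comm (d := d) i j hi hj)

theorem e_comm_g (d n i : ℕ) (hi : 1 ≤ i ∧ i + 1 ≤ n) : Commute (e d n i) (g d n i) := by
  have h1 : SemiconjBy (g d n i) (t d n (i + 1)) (t d n i) := by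
    have := t_mul_g d n i i hi ⟨hi.1, by omega⟩
    rw [Equiv.swap_apply_left] at this
    exact this.symm
  have h2 : SemiconjBy (g d n i) (t d n i) (t d n (i + 1)) := by
    have := t_mul_g d n i (i + 1) hi ⟨by omega, hi.2⟩
    rw [Equiv.swap_apply_right] at this
    exact this.symm
  have hc := t_comm d n i (i + 1) ⟨hi.1, by omega⟩ ⟨by omega, hi.2⟩
  have hp := t_pow_d d n i ⟨hi.1, by omega⟩
  have hq := t_pow_d d n (i + 1) ⟨by omega, hi.2⟩
  have hsum : ∑ m ∈ Finset.range d, t d n i ^ (d - m) * t d n (i + 1) ^ m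
      = ∑ m ∈ Finset.range d, t d n i ^ m * t d n (i + 1) ^ (d - m) := by
    rcases d with _ | k
    · simp
    · rw [Finset.sum_range_succ', Finset.sum_range_succ', ← Finset.sum_range_reflect]
      simp only [Nat.sub_zero, pow_zero, hp, hq]
      congr 1
      refine Finset.sum_congr rfl fun m hm => ?_
      have hm' := Finset.mem_range.mp hm
      congr 2 <;> omega
  have h3 : e d n i * g d n i = g d n i * e d n i := by
    unfold e
    rw [smul_mul_assoc, mul_smul_comm]
    congr 1
    nth_rewrite 2 [← hsum]
    rw [Finset.sum_mul, Finset.mul_sum]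
    refine Finset.sum_congr rfl fun m _ => ?_
    rw [mul_assoc, ← (h2.pow_right (d - m)).eq, ← mul_assoc, ← (h1.pow_right m).eq, mul_assoc,
      (hc.symm.pow_pow m (d - m)).eq]
  exact h3

theorem g_sq (d n i : ℕ) (hi : 1 ≤ i ∧ i + 1 ≤ n) :
    g d n i * g d n i = 1 + (pu - pu⁻¹) • (e d n i * g d n i) := by
  have := proj_rel (Rel.g_sq (d := d) i hi)
  simpa [proj_fe, pow_two, g] using this

theorem g_mul_gInv (d n i : ℕ) (hi : 1 ≤ i ∧ i + 1 ≤ n) : g d n i * gInv d n i = 1 := by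
  rw [gInv, mul_sub, g_sq d n i hi, mul_smul_comm, (e_comm_g d n i hi).eq]
  simp

theorem gInv_mul_g (d n i : ℕ) (hi : 1 ≤ i ∧ i + 1 ≤ n) : gInv d n i * g d n i = 1 := by
  rw [gInv, sub_mul, g_sq d n i hi, smul_mul_assoc]
  simp

/-- `bₖ = gₖ₋₁ ⋯ g₁ b₁ g₁⁻¹ ⋯ gₖ₋₁⁻¹` in `Y_{d,n}^B`, for `1 ≤ k ≤ n`. -/
def bAt (d n : ℕ) : ℕ → Y d n
  | 0 => 1
  | 1 => b d n
  | k + 2 => g d n (k + 1) * bAt d n (k + 1) * gInv d n (k + 1)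

/-- For `1 ≤ j ≤ k ≤ n`, the element `gₖ₋₁ ⋯ gⱼ tⱼ^a` (sign `false`, written `m⁺_{k,j,a}`) or
`gₖ₋₁ ⋯ gⱼ bⱼ tⱼ^a` (sign `true`, written `m⁻_{k,j,a}`) of `Y_{d,n}^B`. -/
def mElt (d n : ℕ) (s : Bool) (j a : ℕ) : ℕ → Y d n
  | 0 => 1
  | k + 1 =>
    if j = k + 1 then (if s then bAt d n j * t d n j ^ a else t d n j ^ a)
    else g d n k * mElt d n s j a k

/-- The set `M_{d,k}`, inside `Y_{d,n}^B`. -/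
def M (d n k : ℕ) : Set (Y d n) :=
  {p | ∃ (s : Bool) (j a : ℕ), 1 ≤ j ∧ j ≤ k ∧ a < d ∧ p = mElt d n s j a k}

/-- Lifting generators to the next algebra of the tower. -/
def genMap (d n : ℕ) : Gen n → Y d (n + 1)
  | .b _ => b d (n + 1)
  | .g i _ => g d (n + 1) i
  | .t j _ => t d (n + 1) j

theorem lift_fb (d n : ℕ) (h : 1 ≤ n) :
    FreeAlgebra.lift 𝕃 (genMap d n) (fb n) = proj d (n + 1) (fb (n + 1)) := by
  simp [fb, h, genMap, b]

theorem lift_fg (d n i : ℕ) (h : 1 ≤ i ∧ i + 1 ≤ n) :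
    FreeAlgebra.lift 𝕃 (genMap d n) (fg n i) = proj d (n + 1) (fg (n + 1) i) := by
  rw [fg, dif_pos h]; simp [genMap, g]

theorem lift_ft (d n j : ℕ) (h : 1 ≤ j ∧ j ≤ n) :
    FreeAlgebra.lift 𝕃 (genMap d n) (ft n j) = proj d (n + 1) (ft (n + 1) j) := by
  rw [ft, dif_pos h]; simp [genMap, t]

theorem swap_range {n i j : ℕ} (hi : 1 ≤ i ∧ i + 1 ≤ n) (hj : 1 ≤ j ∧ j ≤ n) :
    1 ≤ Equiv.swap i (i + 1) j ∧ Equiv.swap i (i + 1) j ≤ n := by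
  rw [Equiv.swap_apply_def]; split_ifs <;> omega

theorem lift_rel (d n : ℕ) {p q : Free n} (h : Rel d n p q) :
    FreeAlgebra.lift 𝕃 (genMap d n) p = FreeAlgebra.lift 𝕃 (genMap d n) q := by
  have up : ∀ {k : ℕ}, 1 ≤ k ∧ k ≤ n → 1 ≤ k ∧ k ≤ n + 1 := fun h => ⟨h.1, by omega⟩
  have ug : ∀ {k : ℕ}, 1 ≤ k ∧ k + 1 ≤ n → 1 ≤ k ∧ k + 1 ≤ n + 1 := fun h => ⟨h.1, by omega⟩
  induction h with
  | g_comm i j hi hj hij =>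
    have := proj_rel (Rel.g_comm (d := d) i j (ug hi) (ug hj) hij)
    simpa [lift_fg, hi, hj] using this
  | g_braid i j hi hj hij =>
    have := proj_rel (Rel.g_braid (d := d) i j (ug hi) (ug hj) hij)
    simpa [lift_fg, hi, hj] using this
  | b_g_comm i hi hi1 =>
    have := proj_rel (Rel.b_g_comm (d := d) i (ug hi) hi1)
    simpa only [map_mul, lift_fg d n i hi, lift_fb d n (by omega)] using this
  | b_g_braid hn =>
    have := proj_rel (Rel.b_g_braid (d := d) (n := n + 1) (by omega))
    simpa only [map_mul, lift_fg d n 1 ⟨le_rfl, hn⟩, lift_fb d n (by omega)] using this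
  | t_comm i j hi hj =>
    have := proj_rel (Rel.t_comm (d := d) i j (up hi) (up hj))
    simpa only [map_mul, lift_ft d n i hi, lift_ft d n j hj] using this
  | t_g i j hi hj =>
    have := proj_rel (Rel.t_g (d := d) i j (ug hi) (up hj))
    simpa only [map_mul, lift_fg d n i hi, lift_ft d n j hj,
      lift_ft d n _ (swap_range hi hj)] using this
  | t_b j hj =>
    have := proj_rel (Rel.t_b (d := d) j (up hj))
    simpa only [map_mul, lift_fb d n (by omega), lift_ft d n j hj] using this
  | t_pow j hj =>
    have := proj_rel (Rel.t_pow (d := d) j (up hj))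
    simpa only [map_pow, map_one, lift_ft d n j hj] using this
  | g_sq i hi =>
    have := proj_rel (Rel.g_sq (d := d) i (ug hi))
    simpa only [map_pow, map_mul, map_add, map_one, map_smul, fe, map_sum, lift_fg d n i hi,
      lift_ft d n i ⟨hi.1, by omega⟩, lift_ft d n (i + 1) ⟨by omega, hi.2⟩] using this
  | b_sq hn =>
    have := proj_rel (Rel.b_sq (d := d) (n := n + 1) (by omega))
    simpa only [map_pow, map_mul, map_add, map_one, map_smul, ff, map_sum, lift_fb d n hn,
      lift_ft d n 1 ⟨le_rfl, hn⟩] using this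

/-- The natural map `Y_{d,n}^B → Y_{d,n+1}^B` of the tower, sending each generator to the generator
of the same name. -/
def incl (d n : ℕ) : Y d n →ₐ[𝕃] Y d (n + 1) :=
  RingQuot.liftAlgHom 𝕃 ⟨FreeAlgebra.lift 𝕃 (genMap d n), fun _ _ h => lift_rel d n h⟩

/-- The set `C_n` of products `m₁ m₂ ⋯ mₙ` with `mₖ ∈ M_{d,k}`. -/
def C (d : ℕ) : (n : ℕ) → Set (Y d n)
  | 0 => {1}
  | n + 1 => {p | ∃ w ∈ C d n, ∃ m ∈ M d (n + 1) (n + 1), p = incl d n w * m}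

theorem lift_rel_zero (d : ℕ) {p q : Free 0} (h : Rel d 0 p q) :
    FreeAlgebra.lift 𝕃 (fun _ : Gen 0 => (0 : 𝕃)) p
      = FreeAlgebra.lift 𝕃 (fun _ : Gen 0 => (0 : 𝕃)) q := by
  induction h <;> omega

/-- The identification of `Y_{d,0}^B` with the ground field (`Gen 0` is empty). -/
def ground (d : ℕ) : Y d 0 →ₐ[𝕃] 𝕃 :=
  RingQuot.liftAlgHom 𝕃 ⟨FreeAlgebra.lift 𝕃 (fun _ : Gen 0 => (0 : 𝕃)),
    fun _ _ h => lift_rel_zero d h⟩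

theorem ground_bijective (d : ℕ) : Function.Bijective (ground d) := by
  have h : (Algebra.ofId 𝕃 (Y d 0)).comp (ground d) = AlgHom.id 𝕃 (Y d 0) := by
    apply RingQuot.ringQuot_ext'
    ext x
    rcases x with h | ⟨i, h⟩ | ⟨j, h⟩ <;> omega
  refine ⟨fun p q hpq => ?_, fun c => ⟨algebraMap 𝕃 _ c, (ground d).commutes c⟩⟩
  have hp := DFunLike.congr_fun h p
  have hq := DFunLike.congr_fun h q
  simp only [AlgHom.comp_apply, AlgHom.id_apply] at hp hq
  rw [← hp, ← hq, hpq]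

/-- `tr n : Y_{d,n+1}^B → Y_{d,n}^B` are the relative traces with parameters `z`, `x`, `y`: they
take the prescribed values on the elements `w m` of `C_{n+1}`, where `w ∈ C_n` and `m` is
`tₙ₊₁^a`, `bₙ₊₁ tₙ₊₁^a`, or `m^±_{n+1,k,a}` with `k ≤ n`. -/
def IsRelTrace (d : ℕ) (x y : Fin d → 𝕃) (tr : (n : ℕ) → Y d (n + 1) →ₗ[𝕃] Y d n) : Prop :=
  ∀ n : ℕ, ∀ w ∈ C d n, ∀ a : Fin d,
    tr n (incl d n w * t d (n + 1) (n + 1) ^ (a : ℕ)) = x a • w ∧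
    tr n (incl d n w * (bAt d (n + 1) (n + 1) * t d (n + 1) (n + 1) ^ (a : ℕ))) = y a • w ∧
    ∀ (s : Bool) (k : ℕ), 1 ≤ k → k ≤ n →
      tr n (incl d n w * mElt d (n + 1) s k a (n + 1)) = pz • (w * mElt d n s k a n)

/-- `Tr_n = tr_1 ∘ ⋯ ∘ tr_n`. -/
def bigTr (d : ℕ) (tr : (n : ℕ) → Y d (n + 1) →ₗ[𝕃] Y d n) : (n : ℕ) → Y d n →ₗ[𝕃] 𝕃
  | 0 => (ground d).toLinearMap
  | n + 1 => (bigTr d tr n).comp (tr n)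

/-- A family of linear maps `Tr_n : Y_{d,n}^B → ℂ(u, v, z)` obeys the rules of a Markov trace with
parameters `z`, `x`, `y` for all `n ≥ 1`. -/
structure IsMarkovTrace (d : ℕ) (x y : Fin d → 𝕃) (Tr : (n : ℕ) → Y d n →ₗ[𝕃] 𝕃) : Prop where
  one : ∀ n, 1 ≤ n → Tr n 1 = 1
  mul_g : ∀ n, 1 ≤ n → ∀ X : Y d n, Tr (n + 1) (incl d n X * g d (n + 1) n) = pz * Tr n X
  mul_b_t : ∀ n, 1 ≤ n → ∀ (X : Y d n) (m : Fin d),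
    Tr (n + 1) (incl d n X * bAt d (n + 1) (n + 1) * t d (n + 1) (n + 1) ^ (m : ℕ)) = y m * Tr n X
  mul_t : ∀ n, 1 ≤ n → ∀ (X : Y d n) (m : Fin d),
    Tr (n + 1) (incl d n X * t d (n + 1) (n + 1) ^ (m : ℕ)) = x m * Tr n X
  comm : ∀ n, 1 ≤ n → ∀ X X' : Y d n, Tr n (X * X') = Tr n (X' * X)

end FramedB

end

noncomputable section

namespace FramedB

/-! ### Generators, relations and the tower -/

/-! Write `T`, `B` for the last framing and the last loop element of `Y_{n+1}`. Everything rests on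
the decomposition `span_D`: `Y_{n+1}` is spanned by the elements `w T^a`, `w B T^a` and `A g_n C`
with `w, A, C` from `Y_n`. The third kind spans a `Y_n`-bimodule `J`, and `B` commutes with `Y_n`
modulo `J`.

Basis: expanding `C` one level down turns the decomposition into `comb_surjective`, so `dim Y_n ≤
n!(2d)^n`. Conversely `Y_n` acts on functions on signed permutations with a colour in `ℤ/d` at each
position. The framings act diagonally by powers of a primitive `d`-th root of unity, and the braid
and loop generators act by Hecke operators that see only equal colours, respectively colour `0`. The
vector `vac` is cyclic (`orbit_surjective`), which gives the opposite inequality. Hence `Y_{n+1}` is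
left free over `Y_n` on `M_{n+1}`, and `C_n` is a basis.

Relative traces: freeness defines `relTr` as a left `Y_n`-linear map, and `tr(A g C) = z A C`
follows. Right linearity reduces to `tr([B, h] T^a) = 0`, checked on the generators `h`. Only `h =
b₁` matters, and there an explicit formula for the commutator makes the terms cancel in pairs.

Trace property: it suffices to commute generators past arbitrary elements. Generators of the smaller
algebra are covered by bilinearity, and the last framing by a direct check. For the last braid
generator `g`, on `J` the claim says that `E(A) = tr(g A g)` is self-adjoint for the form `Tr(A C)`.
Up to visibly symmetric terms, `E` is a bimodule map (`defect`) supported on `J` and determined by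
one value. On the elements `w B T^a` the claim rests on computing `tr(g B T^a)` (`gbVal`) and on a
symmetry of convolution over `ℤ/d`.

Uniqueness: on the three kinds of spanning elements the Markov rules and cyclicity determine
`Tr_{n+1}` from `Tr_n`. `Tr_1` is recovered from `Tr_2` by conjugating with `g_1`. -/

theorem adjoin_induction {d n : ℕ} {p : Y d n → Prop}
    (hb : 1 ≤ n → p (b d n)) (hg : ∀ i, 1 ≤ i ∧ i + 1 ≤ n → p (g d n i))
    (ht : ∀ j, 1 ≤ j ∧ j ≤ n → p (t d n j)) (hc : ∀ c : 𝕃, p (algebraMap 𝕃 _ c))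
    (hadd : ∀ x y, p x → p y → p (x + y)) (hmul : ∀ x y, p x → p y → p (x * y)) (x : Y d n) :
    p x := by
  obtain ⟨f, rfl⟩ : ∃ f, proj d n f = x := RingQuot.mkAlgHom_surjective 𝕃 (Rel d n) x
  induction f using FreeAlgebra.induction with
  | grade0 c => simpa using hc c
  | grade1 y =>
    rcases y with h | ⟨i, h⟩ | ⟨j, h⟩
    · simpa [b, fb, h] using hb h
    · simpa [g, fg, h] using hg i h
    · simpa [t, ft, h] using ht j h
  | mul x y hx hy => rw [map_mul]; exact hmul _ _ hx hy
  | add x y hx hy => rw [map_add]; exact hadd _ _ hx hy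

theorem g_comm {d n i j : ℕ} (hi : 1 ≤ i ∧ i + 1 ≤ n) (hj : 1 ≤ j ∧ j + 1 ≤ n)
    (hij : i + 1 < j ∨ j + 1 < i) : Commute (g d n i) (g d n j) := by
  simpa [g, Commute, SemiconjBy] using proj_rel (Rel.g_comm (d := d) i j hi hj hij)

theorem g_braid {d n i j : ℕ} (hi : 1 ≤ i ∧ i + 1 ≤ n) (hj : 1 ≤ j ∧ j + 1 ≤ n)
    (hij : i + 1 = j ∨ j + 1 = i) :
    g d n i * g d n j * g d n i = g d n j * g d n i * g d n j := by
  simpa [g] using proj_rel (Rel.g_braid (d := d) i j hi hj hij)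

theorem b_g_comm {d n i : ℕ} (hi : 1 ≤ i ∧ i + 1 ≤ n) (hi1 : i ≠ 1) :
    Commute (b d n) (g d n i) := by
  simpa [g, b, Commute, SemiconjBy] using proj_rel (Rel.b_g_comm (d := d) i hi hi1)

theorem b_g_braid {d n : ℕ} (hn : 2 ≤ n) :
    b d n * g d n 1 * b d n * g d n 1 = g d n 1 * b d n * g d n 1 * b d n := by
  simpa [g, b] using proj_rel (Rel.b_g_braid (d := d) hn)

theorem t_b {d n j : ℕ} (hj : 1 ≤ j ∧ j ≤ n) : Commute (t d n j) (b d n) := by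
  simpa [t, b, Commute, SemiconjBy] using proj_rel (Rel.t_b (d := d) j hj)

theorem b_sq {d n : ℕ} (hn : 1 ≤ n) :
    b d n * b d n = 1 + (pv - pv⁻¹) • ((d : 𝕃)⁻¹ • ∑ m ∈ Finset.range d, t d n 1 ^ m) * b d n := by
  have := proj_rel (Rel.b_sq (d := d) hn)
  simpa [ff, b, t, pow_two, map_sum] using this

theorem incl_proj {d n : ℕ} (f : Free n) :
    incl d n (proj d n f) = FreeAlgebra.lift 𝕃 (genMap d n) f :=
  RingQuot.liftAlgHom_mkAlgHom_apply 𝕃 (FreeAlgebra.lift 𝕃 (genMap d n))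
    (fun _ _ h => lift_rel d n h) f

theorem incl_b {d n : ℕ} (hn : 1 ≤ n) : incl d n (b d n) = b d (n + 1) := by
  rw [b, incl_proj, lift_fb d n hn]; rfl

theorem incl_g {d n i : ℕ} (hi : 1 ≤ i ∧ i + 1 ≤ n) : incl d n (g d n i) = g d (n + 1) i := by
  rw [g, incl_proj, lift_fg d n i hi]; rfl

theorem incl_t {d n j : ℕ} (hj : 1 ≤ j ∧ j ≤ n) : incl d n (t d n j) = t d (n + 1) j := by
  rw [t, incl_proj, lift_ft d n j hj]; rfl

theorem incl_e {d n i : ℕ} (hi : 1 ≤ i ∧ i + 1 ≤ n) : incl d n (e d n i) = e d (n + 1) i := by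
  simp only [e, map_smul, map_sum, map_mul, map_pow, incl_t (d := d) (n := n) (j := i) ⟨hi.1, by omega⟩,
    incl_t (d := d) (n := n) (j := i + 1) ⟨by omega, hi.2⟩]

theorem incl_gInv {d n i : ℕ} (hi : 1 ≤ i ∧ i + 1 ≤ n) :
    incl d n (gInv d n i) = gInv d (n + 1) i := by
  simp only [gInv, map_sub, map_smul, incl_e hi, incl_g hi]

theorem incl_bAt {d n k : ℕ} (hk : 1 ≤ k ∧ k ≤ n) : incl d n (bAt d n k) = bAt d (n + 1) k := by
  obtain ⟨h1, h2⟩ := hk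
  induction k, h1 using Nat.le_induction with
  | base => exact incl_b h2
  | succ k h1 ih =>
    obtain ⟨k, rfl⟩ : ∃ l, k = l + 1 := ⟨k - 1, by omega⟩
    simp only [bAt, map_mul, ih (by omega), incl_g (d := d) (n := n) (i := k + 1) ⟨h1, h2⟩,
      incl_gInv (d := d) (n := n) (i := k + 1) ⟨h1, h2⟩]

theorem mElt_self {d n k : ℕ} (s : Bool) (a : ℕ) :
    mElt d n s (k + 1) a (k + 1)
      = if s then bAt d n (k + 1) * t d n (k + 1) ^ a else t d n (k + 1) ^ a := by
  simp [mElt]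

theorem mElt_succ {d n j k : ℕ} (s : Bool) (a : ℕ) (h : j ≤ k) :
    mElt d n s j a (k + 1) = g d n k * mElt d n s j a k := by
  rw [mElt, if_neg (by omega)]

theorem incl_mElt {d n j k : ℕ} (s : Bool) (a : ℕ) (hj : 1 ≤ j) (hk : j ≤ k) (hn : k ≤ n) :
    incl d n (mElt d n s j a k) = mElt d (n + 1) s j a k := by
  induction k, hk using Nat.le_induction with
  | base =>
    obtain ⟨j, rfl⟩ : ∃ l, j = l + 1 := ⟨j - 1, by omega⟩
    cases s <;> simp [mElt_self, incl_bAt (d := d) ⟨hj, hn⟩, incl_t (d := d) ⟨hj, hn⟩]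
  | succ k hk ih =>
    rw [mElt_succ _ _ hk, mElt_succ _ _ hk, map_mul, ih (by omega), incl_g ⟨by omega, hn⟩]

/-! ### Commutation rules -/

theorem t_semiconj_g {d n i j : ℕ} (hi : 1 ≤ i ∧ i + 1 ≤ n) (hj : 1 ≤ j ∧ j ≤ n) :
    SemiconjBy (g d n i) (t d n (Equiv.swap i (i + 1) j)) (t d n j) :=
  (t_mul_g d n i j hi hj).symm

theorem g_semiconj_left {d n i : ℕ} (hi : 1 ≤ i ∧ i + 1 ≤ n) :
    SemiconjBy (g d n i) (t d n (i + 1)) (t d n i) := by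
  simpa using t_semiconj_g (d := d) hi (j := i) ⟨hi.1, by omega⟩

theorem g_semiconj_right {d n i : ℕ} (hi : 1 ≤ i ∧ i + 1 ≤ n) :
    SemiconjBy (g d n i) (t d n i) (t d n (i + 1)) := by
  simpa using t_semiconj_g (d := d) hi (j := i + 1) ⟨by omega, hi.2⟩

theorem t_g_comm {d n i j : ℕ} (hi : 1 ≤ i ∧ i + 1 ≤ n) (hj : 1 ≤ j ∧ j ≤ n) (h1 : j ≠ i)
    (h2 : j ≠ i + 1) : Commute (t d n j) (g d n i) := by
  have := t_semiconj_g (d := d) hi hj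
  rw [Equiv.swap_apply_of_ne_of_ne h1 h2] at this
  exact Commute.symm this

/-- `gᵢ` as a unit. -/
def gU (d n i : ℕ) (hi : 1 ≤ i ∧ i + 1 ≤ n) : (Y d n)ˣ :=
  ⟨g d n i, gInv d n i, g_mul_gInv d n i hi, gInv_mul_g d n i hi⟩

theorem gInv_semiconj {d n i : ℕ} (hi : 1 ≤ i ∧ i + 1 ≤ n) {x y : Y d n}
    (h : SemiconjBy (g d n i) x y) : SemiconjBy (gInv d n i) y x :=
  SemiconjBy.units_inv_symm_left (a := gU d n i hi) h

theorem commute_gInv {d n i : ℕ} (hi : 1 ≤ i ∧ i + 1 ≤ n) {x : Y d n}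
    (h : Commute x (g d n i)) : Commute x (gInv d n i) :=
  (gInv_semiconj hi h.symm).symm

theorem semiconj_conj {d n i : ℕ} (hi : 1 ≤ i ∧ i + 1 ≤ n) (x : Y d n) :
    SemiconjBy (g d n i) x (g d n i * x * gInv d n i) := by
  rw [SemiconjBy, mul_assoc _ (gInv d n i), gInv_mul_g d n i hi, mul_one]

theorem bAt_succ {d n k : ℕ} (hk : 1 ≤ k) :
    bAt d n (k + 1) = g d n k * bAt d n k * gInv d n k := by
  obtain ⟨k, rfl⟩ : ∃ l, k = l + 1 := ⟨k - 1, by omega⟩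
  rfl

theorem g_semiconj_bAt {d n k : ℕ} (hk : 1 ≤ k ∧ k + 1 ≤ n) :
    SemiconjBy (g d n k) (bAt d n k) (bAt d n (k + 1)) := by
  rw [bAt_succ hk.1]; exact semiconj_conj hk _

theorem t_bAt {d n j k : ℕ} (hj : 1 ≤ j ∧ j ≤ n) (hk : 1 ≤ k ∧ k ≤ n) :
    Commute (t d n j) (bAt d n k) := by
  obtain ⟨h1, h2⟩ := hk
  induction k, h1 using Nat.le_induction generalizing j with
  | base => exact t_b hj
  | succ k h1 ih =>
    have hi : 1 ≤ k ∧ k + 1 ≤ n := ⟨h1, h2⟩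
    have hs := t_semiconj_g (d := d) hi hj
    have hc := ih (swap_range hi hj) (by omega)
    rw [bAt_succ h1, Commute, SemiconjBy, ← mul_assoc, ← mul_assoc, ← hs.eq, mul_assoc _ _ (bAt d n k),
      hc.eq, mul_assoc _ (gInv d n k), (gInv_semiconj hi hs).eq]
    simp only [mul_assoc]

theorem g_bAt_of_lt {d n i k : ℕ} (hi : k + 1 ≤ i ∧ i + 1 ≤ n) (hk : 1 ≤ k) :
    Commute (g d n i) (bAt d n k) := by
  induction k, hk using Nat.le_induction with
  | base => exact (b_g_comm ⟨by omega, hi.2⟩ (by omega)).symm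
  | succ k h1 ih =>
    have h := g_comm (d := d) (n := n) (i := i) (j := k) ⟨by omega, hi.2⟩ ⟨h1, by omega⟩
      (by omega)
    rw [bAt_succ h1]
    exact (h.mul_right (ih (by omega))).mul_right (commute_gInv ⟨h1, by omega⟩ h)

/-- Conjugation by `gₖ gₖ₊₁` carries `gₖ` to `gₖ₊₁`. -/
theorem g_g_semiconj {d n k : ℕ} (hk : 1 ≤ k ∧ k + 2 ≤ n) :
    SemiconjBy (g d n k * g d n (k + 1)) (g d n k) (g d n (k + 1)) := by
  rw [SemiconjBy, g_braid ⟨hk.1, by omega⟩ ⟨by omega, by omega⟩ (Or.inl rfl), mul_assoc]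

theorem g_g_semiconj_bAt {d n k : ℕ} (hk : 1 ≤ k ∧ k + 2 ≤ n) :
    SemiconjBy (g d n k * g d n (k + 1)) (bAt d n k) (bAt d n (k + 1)) :=
  (g_semiconj_bAt ⟨hk.1, by omega⟩).mul_left (g_bAt_of_lt ⟨by omega, by omega⟩ hk.1)

/-- At `k = i + 2`, `b_k` is `b_i` conjugated by `g_{i+1} g_i`. That conjugation carries `g_{i+1}`,
which commutes with `b_i`, to `g_i`. Beyond that, `g_i` commutes with every new conjugating factor.
-/
theorem g_bAt_of_gt {d n i k : ℕ} (hi : 1 ≤ i) (hk : i + 2 ≤ k ∧ k ≤ n) :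
    Commute (g d n i) (bAt d n k) := by
  obtain ⟨h1, h2⟩ := hk
  induction k, h1 using Nat.le_induction with
  | base =>
    have hA := g_g_semiconj (d := d) (k := i) ⟨hi, h2⟩
    have hB : SemiconjBy (g d n (i + 1) * g d n i) (g d n (i + 1)) (g d n i) := by
      rw [SemiconjBy, g_braid ⟨by omega, by omega⟩ ⟨by omega, by omega⟩ (Or.inr rfl), mul_assoc]
    have hb := g_bAt_of_lt (d := d) (n := n) (i := i + 1) (k := i) ⟨by omega, by omega⟩ hi
    have hu : (g d n (i + 1) * g d n i) * (gInv d n i * gInv d n (i + 1)) = 1 := by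
      rw [mul_assoc, ← mul_assoc (g d n i), g_mul_gInv d n i ⟨by omega, by omega⟩, one_mul,
        g_mul_gInv d n _ ⟨by omega, by omega⟩]
    have hv : (gInv d n i * gInv d n (i + 1)) * (g d n (i + 1) * g d n i) = 1 := by
      rw [mul_assoc, ← mul_assoc (gInv d n (i + 1)), gInv_mul_g d n _ ⟨by omega, by omega⟩,
        one_mul, gInv_mul_g d n _ ⟨by omega, by omega⟩]
    have hI : SemiconjBy (gInv d n i * gInv d n (i + 1)) (g d n i) (g d n (i + 1)) :=
      SemiconjBy.units_inv_symm_left (a := ⟨_, _, hu, hv⟩) hB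
    have : bAt d n (i + 2)
        = (g d n (i + 1) * g d n i) * bAt d n i * (gInv d n i * gInv d n (i + 1)) := by
      rw [bAt_succ (by omega), bAt_succ hi]; simp only [mul_assoc]
    rw [this]
    exact Commute.symm ((hB.mul_left hb.symm.semiconjBy).mul_left hI)
  | succ k h1 ih =>
    have h := g_comm (d := d) (n := n) (i := i) (j := k) ⟨hi, by omega⟩ ⟨by omega, by omega⟩
      (by omega)
    rw [bAt_succ (by omega)]
    exact (h.mul_right (ih (by omega))).mul_right (commute_gInv ⟨by omega, by omega⟩ h)

/-! ### The last generators of the tower -/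

/-- Conjugation by `g_k g_{k+1}` carries the pair `(b_k, g_k)` to `(b_{k+1}, g_{k+1})`, so the type
B braid relation is transported along the tower from `k = 1`. -/
theorem bAt_braid {d n k : ℕ} (hk : 1 ≤ k) (hn : k + 1 ≤ n) :
    bAt d n k * g d n k * bAt d n k * g d n k = g d n k * bAt d n k * g d n k * bAt d n k := by
  induction k, hk using Nat.le_induction with
  | base => exact b_g_braid hn
  | succ k h1 ih =>
    have hg := g_g_semiconj (d := d) (n := n) (k := k) ⟨h1, hn⟩
    have hb := g_g_semiconj_bAt (d := d) (n := n) (k := k) ⟨h1, hn⟩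
    have h := ((hb.mul_right hg).mul_right hb).mul_right hg
    have h' := ((hg.mul_right hb).mul_right hg).mul_right hb
    rw [SemiconjBy, ih (by omega), h'.eq] at h
    have hu : IsUnit (g d n k * g d n (k + 1)) :=
      (gU d n k ⟨h1, by omega⟩).isUnit.mul (gU d n (k + 1) ⟨by omega, hn⟩).isUnit
    exact (hu.mul_left_injective h).symm

theorem t_last_comm {d n : ℕ} (X : Y d n) : Commute (t d (n + 1) (n + 1)) (incl d n X) := by
  induction X using adjoin_induction with
  | hb h => rw [incl_b h]; exact t_b ⟨by omega, le_rfl⟩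
  | hg i h => rw [incl_g h]; exact t_g_comm ⟨h.1, by omega⟩ ⟨by omega, le_rfl⟩ (by omega) (by omega)
  | ht j h => rw [incl_t h]; exact t_comm d _ _ _ ⟨by omega, le_rfl⟩ ⟨h.1, by omega⟩
  | hc c => rw [AlgHom.commutes]; exact (Algebra.commutes c _).symm
  | hadd x y hx hy => rw [map_add]; exact hx.add_right hy
  | hmul x y hx hy => rw [map_mul]; exact hx.mul_right hy

theorem g_last_comm {d n : ℕ} (X : Y d n) :
    Commute (g d (n + 2) (n + 1)) (incl d (n + 1) (incl d n X)) := by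
  induction X using adjoin_induction with
  | hb h => rw [incl_b h, incl_b (by omega)]; exact (b_g_comm ⟨by omega, le_rfl⟩ (by omega)).symm
  | hg i h =>
    rw [incl_g h, incl_g ⟨h.1, by omega⟩]
    exact g_comm ⟨by omega, le_rfl⟩ ⟨h.1, by omega⟩ (by omega)
  | ht j h =>
    rw [incl_t h, incl_t ⟨h.1, by omega⟩]
    exact (t_g_comm ⟨by omega, le_rfl⟩ ⟨h.1, by omega⟩ (by omega) (by omega)).symm
  | hc c => rw [AlgHom.commutes, AlgHom.commutes]; exact (Algebra.commutes c _).symm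
  | hadd x y hx hy => rw [map_add, map_add]; exact hx.add_right hy
  | hmul x y hx hy => rw [map_mul, map_mul]; exact hx.mul_right hy

/-- The scalar `(u - u⁻¹) / d`. -/
def ud (d : ℕ) : 𝕃 := (pu - pu⁻¹) * (d : 𝕃)⁻¹

theorem gInv_eq {d n i : ℕ} : gInv d n i
    = g d n i - ud d • ∑ m ∈ Finset.range d, t d n i ^ m * t d n (i + 1) ^ (d - m) := by
  rw [gInv, e, ud, mul_smul]

section Last
variable {d n : ℕ}

local notation "ι" => incl d (n + 1)
local notation "G" => g d (n + 2) (n + 1)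
local notation "G'" => gInv d (n + 2) (n + 1)
local notation "T₀" => t d (n + 1) (n + 1)
local notation "T₁" => t d (n + 2) (n + 2)
local notation "B₀" => bAt d (n + 1) (n + 1)
local notation "B₁" => bAt d (n + 2) (n + 2)

theorem incl_t_last : ι T₀ = t d (n + 2) (n + 1) := incl_t ⟨by omega, le_rfl⟩

theorem incl_bAt_last : ι B₀ = bAt d (n + 2) (n + 1) := incl_bAt ⟨by omega, le_rfl⟩

theorem G_mul_inv : G * G' = 1 := g_mul_gInv _ _ _ ⟨by omega, le_rfl⟩

theorem inv_mul_G : G' * G = 1 := gInv_mul_g _ _ _ ⟨by omega, le_rfl⟩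

theorem G_mul_T (a : ℕ) : G * T₁ ^ a = ι (T₀ ^ a) * G := by
  rw [map_pow, incl_t_last]
  exact ((g_semiconj_left ⟨by omega, le_rfl⟩).pow_right a).eq

theorem G_mul_incl_T (a : ℕ) : G * ι (T₀ ^ a) = T₁ ^ a * G := by
  rw [map_pow, incl_t_last]
  exact ((g_semiconj_right ⟨by omega, le_rfl⟩).pow_right a).eq

theorem G_mul_incl_B : G * ι B₀ = B₁ * G := by
  rw [incl_bAt_last]; exact (g_semiconj_bAt ⟨by omega, le_rfl⟩).eq

theorem bAt_last : B₁ = G * ι B₀ * G' := by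
  rw [incl_bAt_last, bAt_succ (by omega)]

theorem T_pow_comm (a : ℕ) (X : Y d (n + 1)) : T₁ ^ a * ι X = ι X * T₁ ^ a :=
  ((t_last_comm X).pow_left a).eq

theorem T_pow_comm_assoc (a : ℕ) (X : Y d (n + 1)) (Z : Y d (n + 2)) :
    T₁ ^ a * (ι X * Z) = ι X * (T₁ ^ a * Z) := by
  rw [← mul_assoc, T_pow_comm, mul_assoc]

theorem T_B_comm (a : ℕ) : T₁ ^ a * B₁ = B₁ * T₁ ^ a :=
  ((t_bAt ⟨by omega, le_rfl⟩ ⟨by omega, le_rfl⟩).pow_left a).eq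

theorem T₀_B₁_comm (a : ℕ) : ι (T₀ ^ a) * B₁ = B₁ * ι (T₀ ^ a) := by
  rw [map_pow, incl_t_last]
  exact ((t_bAt ⟨by omega, by omega⟩ ⟨by omega, le_rfl⟩).pow_left a).eq

theorem G_incl_comm (W : Y d n) : G * ι (incl d n W) = ι (incl d n W) * G := (g_last_comm W).eq

theorem inv_incl_comm (W : Y d n) : G' * ι (incl d n W) = ι (incl d n W) * G' :=
  (commute_gInv ⟨by omega, le_rfl⟩ (g_last_comm W).symm).symm.eq

theorem inv_eq : G' = G - ud d • ∑ m ∈ Finset.range d, ι (T₀ ^ m) * T₁ ^ (d - m) := by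
  rw [gInv_eq]; simp only [map_pow, incl_t_last]

theorem B_T_comm (a : ℕ) : T₀ ^ a * B₀ = B₀ * T₀ ^ a :=
  ((t_bAt ⟨by omega, le_rfl⟩ ⟨by omega, le_rfl⟩).pow_left a).eq

/-- The right-hand `g` is replaced by `g⁻¹` plus its framing correction. The powers of `T₁` in the
correction are then moved left through `Z` and become powers of `T₀` on crossing `g`. -/
theorem G_incl_G (Z : Y d (n + 1)) : G * ι Z * G = G * ι Z * G'
    + ud d • ∑ m ∈ Finset.range d, ι (T₀ ^ (d - m)) * G * ι (Z * T₀ ^ m) := by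
  rw [inv_eq, mul_sub, mul_smul_comm, Finset.mul_sum, sub_add, ← smul_sub, ← Finset.sum_sub_distrib,
    Finset.sum_eq_zero, smul_zero, sub_zero]
  intro m _
  rw [sub_eq_zero, ← G_mul_T, ← T_pow_comm, map_mul]
  simp only [← mul_assoc]
  rw [mul_assoc (G) (ι Z), ← T_pow_comm, ← mul_assoc]

theorem G_T_inv (a : ℕ) : G * ι (T₀ ^ a) * G' = T₁ ^ a := by
  rw [G_mul_incl_T, mul_assoc, G_mul_inv, mul_one]

theorem G_BT_inv (a : ℕ) : G * ι (B₀ * T₀ ^ a) * G' = B₁ * T₁ ^ a := by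
  rw [map_mul, ← mul_assoc, G_mul_incl_B, mul_assoc B₁, G_mul_incl_T, mul_assoc B₁, mul_assoc,
    G_mul_inv, mul_one]

/-- `bₙ₊₂ bₙ₊₁ - bₙ₊₁ bₙ₊₂`. -/
theorem bAt_commutator : B₁ * ι B₀ - ι B₀ * B₁
    = ud d • ∑ m ∈ Finset.range d, (ι (B₀ * T₀ ^ m) * G * ι (T₀ ^ (d - m) * B₀)
        - ι (T₀ ^ (d - m)) * G * ι (T₀ ^ m * (B₀ * B₀))) := by
  have hbr : ι B₀ * G * ι B₀ * G = G * ι B₀ * G * ι B₀ := by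
    rw [incl_bAt_last]; exact bAt_braid (by omega) le_rfl
  -- The braid relation makes both products end in `B₀` with a single inverse. After expanding `g⁻¹`
  -- the terms `g B₀ g B₀` cancel and only the framing corrections remain.
  have h1 : ι B₀ * B₁ = G' * ι B₀ * G * ι B₀ := by
    have := congrArg (fun z => G' * z * G') hbr
    simp only [mul_assoc, G_mul_inv, mul_one] at this
    simp only [← mul_assoc, inv_mul_G, one_mul] at this
    rw [bAt_last, this]
    simp only [← mul_assoc]
  have h2 : B₁ * ι B₀ = G * ι B₀ * G' * ι B₀ := by rw [bAt_last]
  rw [h1, h2, inv_eq]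
  simp only [mul_sub, sub_mul, mul_smul_comm, smul_mul_assoc, Finset.mul_sum, Finset.sum_mul,
    Finset.sum_sub_distrib, smul_sub]
  rw [sub_sub_sub_cancel_left]
  congr 2
  · refine Finset.sum_congr rfl fun m _ => ?_
    rw [← B_T_comm, map_mul, map_mul]
    simp only [mul_assoc]
    rw [← mul_assoc (T₁ ^ _), T_pow_comm, ← mul_assoc G (ι _), G_mul_incl_T]
    simp only [mul_assoc]
  · refine Finset.sum_congr rfl fun m _ => ?_
    rw [← G_mul_T, ← mul_assoc (T₀ ^ m), B_T_comm]
    simp only [map_mul, mul_assoc, T_pow_comm, T_pow_comm_assoc]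

end Last

/-- An explicit form of `bₙ₊₂ b₁ - b₁ bₙ₊₂`. -/
theorem bAt_b_commutator (d n : ℕ) : ∃ P P' : Y d (n + 1), P * P' = 1 ∧
    P * t d (n + 1) (n + 1) = t d (n + 1) 1 * P ∧
    bAt d (n + 2) (n + 2) * incl d (n + 1) (b d (n + 1))
      - incl d (n + 1) (b d (n + 1)) * bAt d (n + 2) (n + 2)
    = ud d • ∑ m ∈ Finset.range d,
      (incl d (n + 1) (b d (n + 1) * t d (n + 1) 1 ^ m * P) * g d (n + 2) (n + 1)
          * incl d (n + 1) (P' * (t d (n + 1) 1 ^ (d - m) * b d (n + 1)))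
        - incl d (n + 1) (t d (n + 1) 1 ^ (d - m) * P) * g d (n + 2) (n + 1)
          * incl d (n + 1) (P' * (t d (n + 1) 1 ^ m * (b d (n + 1) * b d (n + 1))))) := by
  induction n with
  | zero => exact ⟨1, 1, by simp, by simp, by simpa [bAt] using bAt_commutator (d := d) (n := 0)⟩
  | succ n ih =>
    obtain ⟨P, P', hP, hT, h⟩ := ih
    have hk : 1 ≤ n + 1 ∧ n + 1 + 1 ≤ n + 2 := ⟨by omega, le_rfl⟩
    -- By recursion `P = g₁⁻¹ ⋯ g_{n+1}⁻¹` and `P'` is its inverse, so `P` carries the last framing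
    -- to `t₁`.
    refine ⟨incl d (n + 1) P * gInv d (n + 2) (n + 1), g d (n + 2) (n + 1) * incl d (n + 1) P',
      ?_, ?_, ?_⟩
    · rw [mul_assoc, ← mul_assoc (gInv _ _ _), gInv_mul_g d _ _ hk, one_mul, ← map_mul, hP, map_one]
    · rw [mul_assoc, (gInv_semiconj hk (g_semiconj_right hk)).eq, ← mul_assoc,
        ← incl_t_last, ← map_mul, hT, map_mul, incl_t ⟨le_rfl, by omega⟩, mul_assoc]
    -- The new commutator is the old one conjugated by `g_{n+2}`, which commutes with `b₁`. The
    -- braid relation in the form `g_{n+2} g_{n+1} g_{n+2}⁻¹ = g_{n+1}⁻¹ g_{n+2} g_{n+1}` then puts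
    -- each summand back into the required shape.
    · have key (A C : Y d (n + 1)) :
          g d (n + 3) (n + 2) * incl d (n + 2) (incl d (n + 1) A * g d (n + 2) (n + 1)
            * incl d (n + 1) C) * gInv d (n + 3) (n + 2)
          = incl d (n + 2) (incl d (n + 1) A * gInv d (n + 2) (n + 1)) * g d (n + 3) (n + 2)
            * incl d (n + 2) (g d (n + 2) (n + 1) * incl d (n + 1) C) := by
        have hb : g d (n + 3) (n + 2) * g d (n + 3) (n + 1) * gInv d (n + 3) (n + 2)
            = gInv d (n + 3) (n + 1) * g d (n + 3) (n + 2) * g d (n + 3) (n + 1) := by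
          have h1 : 1 ≤ n + 1 ∧ n + 1 + 1 ≤ n + 3 := ⟨by omega, by omega⟩
          have h2 : 1 ≤ n + 2 ∧ n + 2 + 1 ≤ n + 3 := ⟨by omega, by omega⟩
          have hbr := g_braid (d := d) h1 h2 (Or.inl rfl)
          have := congrArg (fun z => gInv d (n + 3) (n + 1) * z * gInv d (n + 3) (n + 2)) hbr
          simp only [← mul_assoc, gInv_mul_g d _ _ h1, one_mul] at this
          rw [this, mul_assoc _ (g d (n + 3) (n + 2)) (gInv _ _ _), g_mul_gInv d _ _ h2, mul_one]
        simp only [map_mul, incl_g hk, incl_gInv hk]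
        simp only [mul_assoc]
        rw [← inv_incl_comm, ← mul_assoc (g d (n + 3) (n + 2)), G_incl_comm]
        simp only [mul_assoc]
        congr 1
        simp only [← mul_assoc] at hb ⊢
        rw [hb]
      have h' := congrArg (fun z => g d (n + 3) (n + 2) * incl d (n + 2) z
        * gInv d (n + 3) (n + 2)) h
      simp only [map_smul, map_sum, map_sub, mul_smul_comm, smul_mul_assoc, mul_sub, sub_mul,
        Finset.mul_sum, Finset.sum_mul, key] at h'
      have hL : bAt d (n + 3) (n + 3) * incl d (n + 2) (b d (n + 2))
          - incl d (n + 2) (b d (n + 2)) * bAt d (n + 3) (n + 3)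
          = g d (n + 3) (n + 2) * incl d (n + 2) (bAt d (n + 2) (n + 2) * incl d (n + 1) (b d (n + 1)))
              * gInv d (n + 3) (n + 2)
            - g d (n + 3) (n + 2) * incl d (n + 2) (incl d (n + 1) (b d (n + 1)) * bAt d (n + 2) (n + 2))
              * gInv d (n + 3) (n + 2) := by
        rw [bAt_last, ← incl_b (d := d) (n := n + 1) (by omega), map_mul, map_mul]
        simp only [mul_assoc]
        rw [inv_incl_comm, ← mul_assoc (g d (n + 3) (n + 2)) (incl _ _ (incl _ _ _)), G_incl_comm]
        simp only [mul_assoc]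
      rw [hL, h']
      simp only [map_mul, map_pow, incl_t (d := d) (n := n + 1) (j := 1) ⟨le_rfl, by omega⟩,
        incl_b (d := d) (n := n + 1) (by omega), mul_assoc]

/-! ### Decomposition of `Y_{n+1}` over `Y_n` -/

/-- The subbimodule `Y_n g_n Y_n` of `Y_{n+1}`. -/
def J (d n : ℕ) : Submodule 𝕃 (Y d (n + 1)) :=
  Submodule.span 𝕃 {X | 1 ≤ n ∧ ∃ A C : Y d n, X = incl d n A * g d (n + 1) n * incl d n C}

theorem span_le_comap {A : Type*} [AddCommGroup A] [Module 𝕃 A] {A' : Type*} [AddCommGroup A']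
    [Module 𝕃 A'] {s : Set A} {S : Submodule 𝕃 A'} (f : A →ₗ[𝕃] A') (h : ∀ x ∈ s, f x ∈ S) {x : A}
    (hx : x ∈ Submodule.span 𝕃 s) : f x ∈ S :=
  (Submodule.span_le (p := S.comap f)).mpr h hx

theorem mem_J {d n : ℕ} (A C : Y d (n + 1)) :
    incl d (n + 1) A * g d (n + 2) (n + 1) * incl d (n + 1) C ∈ J d (n + 1) :=
  Submodule.subset_span ⟨by omega, A, C, rfl⟩

theorem J_left {d n : ℕ} (h : Y d n) {X : Y d (n + 1)} (hX : X ∈ J d n) : incl d n h * X ∈ J d n := by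
  refine span_le_comap (LinearMap.mulLeft 𝕃 (incl d n h)) ?_ hX
  rintro _ ⟨hn, A, C, rfl⟩
  exact Submodule.subset_span ⟨hn, h * A, C, by simp [mul_assoc]⟩

theorem J_right {d n : ℕ} (h : Y d n) {X : Y d (n + 1)} (hX : X ∈ J d n) : X * incl d n h ∈ J d n := by
  refine span_le_comap (LinearMap.mulRight 𝕃 (incl d n h)) ?_ hX
  rintro _ ⟨hn, A, C, rfl⟩
  exact Submodule.subset_span ⟨hn, A, C * h, by simp [mul_assoc]⟩

theorem incl_G_incl_T {d n : ℕ} (A C : Y d (n + 1)) (a : ℕ) :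
    incl d (n + 1) A * g d (n + 2) (n + 1) * incl d (n + 1) C * t d (n + 2) (n + 2) ^ a
      = incl d (n + 1) (A * t d (n + 1) (n + 1) ^ a) * g d (n + 2) (n + 1) * incl d (n + 1) C := by
  rw [mul_assoc, ← T_pow_comm, ← mul_assoc, mul_assoc (incl d (n + 1) A), G_mul_T, map_mul]
  simp only [mul_assoc]

theorem J_T {d n : ℕ} (a : ℕ) {X : Y d (n + 1)} (hX : X ∈ J d n) :
    X * t d (n + 1) (n + 1) ^ a ∈ J d n := by
  refine span_le_comap (LinearMap.mulRight 𝕃 (t d (n + 1) (n + 1) ^ a)) ?_ hX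
  rintro _ ⟨hn, A, C, rfl⟩
  obtain ⟨n, rfl⟩ : ∃ k, n = k + 1 := ⟨n - 1, by omega⟩
  rw [LinearMap.mulRight_apply, incl_G_incl_T]
  exact mem_J _ _

/-- The commutator with `b_{n+1}` is a derivation and `J` is a `Y_n`-bimodule, so generators
suffice. Of these only `b₁` fails to commute with `b_{n+1}`. -/
theorem bAt_incl_sub_mem_J {d n : ℕ} (h : Y d n) :
    bAt d (n + 1) (n + 1) * incl d n h - incl d n h * bAt d (n + 1) (n + 1) ∈ J d n := by
  have of_comm {X : Y d (n + 1)} (hX : Commute X (bAt d (n + 1) (n + 1))) :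
      bAt d (n + 1) (n + 1) * X - X * bAt d (n + 1) (n + 1) ∈ J d n := by
    rw [hX.eq, sub_self]; exact zero_mem _
  induction h using adjoin_induction with
  | hb h =>
    obtain ⟨n, rfl⟩ : ∃ k, n = k + 1 := ⟨n - 1, by omega⟩
    obtain ⟨P, P', -, -, h⟩ := bAt_b_commutator d n
    rw [h]
    exact Submodule.smul_mem _ _ (Submodule.sum_mem _ fun m _ =>
      Submodule.sub_mem _ (mem_J _ _) (mem_J _ _))
  | hg i h => rw [incl_g h]; exact of_comm (g_bAt_of_gt h.1 ⟨by omega, le_rfl⟩)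
  | ht j h => rw [incl_t h]; exact of_comm (t_bAt ⟨h.1, by omega⟩ ⟨by omega, le_rfl⟩)
  | hc c => rw [AlgHom.commutes]; exact of_comm (Algebra.commutes c _)
  | hadd x y hx hy =>
    rw [map_add]
    convert add_mem hx hy using 1
    noncomm_ring
  | hmul x y hx hy =>
    rw [map_mul]
    convert add_mem (J_right y hx) (J_left x hy) using 1
    noncomm_ring

/-- The elements `w t^a`, `w b t^a` and `w gₙ w'` of `Y_{n+1}`, for `w, w'` in `Y_n`. -/
def D (d n : ℕ) : Set (Y d (n + 1)) :=
  {X | (∃ W a, X = incl d n W * t d (n + 1) (n + 1) ^ a) ∨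
    (∃ W a, X = incl d n W * (bAt d (n + 1) (n + 1) * t d (n + 1) (n + 1) ^ a)) ∨
    (1 ≤ n ∧ ∃ A C : Y d n, X = incl d n A * g d (n + 1) n * incl d n C)}

theorem J_le_span_D {d n : ℕ} : J d n ≤ Submodule.span 𝕃 (D d n) :=
  Submodule.span_mono fun _ h => Or.inr (Or.inr h)

theorem mem_span_D_T {d n : ℕ} (W : Y d n) (a : ℕ) :
    incl d n W * t d (n + 1) (n + 1) ^ a ∈ Submodule.span 𝕃 (D d n) :=
  Submodule.subset_span (Or.inl ⟨W, a, rfl⟩)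

theorem mem_span_D_B {d n : ℕ} (W : Y d n) (a : ℕ) :
    incl d n W * (bAt d (n + 1) (n + 1) * t d (n + 1) (n + 1) ^ a) ∈ Submodule.span 𝕃 (D d n) :=
  Submodule.subset_span (Or.inr (Or.inl ⟨W, a, rfl⟩))

theorem span_D_mul_incl {d n : ℕ} (h : Y d n) {X : Y d (n + 1)}
    (hX : X ∈ Submodule.span 𝕃 (D d n)) : X * incl d n h ∈ Submodule.span 𝕃 (D d n) := by
  refine span_le_comap (LinearMap.mulRight 𝕃 (incl d n h)) ?_ hX
  rintro _ (⟨W, a, rfl⟩ | ⟨W, a, rfl⟩ | ⟨hn, A, C, rfl⟩)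
  · rw [LinearMap.mulRight_apply, mul_assoc, ((t_last_comm h).pow_left a).eq, ← mul_assoc, ← map_mul]
    exact mem_span_D_T _ _
  · have := J_T a (J_left W (bAt_incl_sub_mem_J h))
    convert add_mem (mem_span_D_B (W * h) a) (J_le_span_D this) using 1
    rw [LinearMap.mulRight_apply, mul_assoc, mul_assoc _ _ (incl d n h),
      ((t_last_comm h).pow_left a).eq, map_mul]
    noncomm_ring
  · exact J_le_span_D (J_right h (Submodule.subset_span ⟨hn, A, C, rfl⟩))

theorem span_D_mul_T {d n : ℕ} {X : Y d (n + 1)} (hX : X ∈ Submodule.span 𝕃 (D d n)) :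
    X * t d (n + 1) (n + 1) ∈ Submodule.span 𝕃 (D d n) := by
  refine span_le_comap (LinearMap.mulRight 𝕃 (t d (n + 1) (n + 1))) ?_ hX
  rintro _ (⟨W, a, rfl⟩ | ⟨W, a, rfl⟩ | ⟨hn, A, C, rfl⟩)
  · rw [LinearMap.mulRight_apply, mul_assoc, ← pow_succ]
    exact mem_span_D_T _ _
  · rw [LinearMap.mulRight_apply, mul_assoc, mul_assoc, ← pow_succ]
    exact mem_span_D_B _ _
  · have := J_T 1 (n := n) (Submodule.subset_span ⟨hn, A, C, rfl⟩)
    rw [pow_one] at this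
    exact J_le_span_D this

/-- `g_{n+2}` commutes with `W` and `W'`, so both can be pulled out and the braid relation applied
to the core `g_{n+2} g_{n+1} g_{n+2}`. -/
theorem G_conj_g {d n : ℕ} (W W' : Y d (n + 1)) :
    g d (n + 3) (n + 2) * incl d (n + 2) (incl d (n + 1) W * g d (n + 2) (n + 1) * incl d (n + 1) W')
        * g d (n + 3) (n + 2)
      = incl d (n + 2) (incl d (n + 1) W * g d (n + 2) (n + 1)) * g d (n + 3) (n + 2)
        * incl d (n + 2) (g d (n + 2) (n + 1) * incl d (n + 1) W') := by
  have hbr := g_braid (d := d) (n := n + 3) (i := n + 1) (j := n + 2) ⟨by omega, by omega⟩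
    ⟨by omega, by omega⟩ (Or.inl rfl)
  simp only [map_mul, incl_g (d := d) (n := n + 2) (i := n + 1) ⟨by omega, by omega⟩, mul_assoc]
  rw [← G_incl_comm W', ← mul_assoc (g d (n + 3) (n + 2)), G_incl_comm]
  simp only [mul_assoc] at hbr ⊢
  rw [← mul_assoc (g d (n + 3) (n + 1)) _ (incl _ _ _), ← mul_assoc (g d (n + 3) (n + 2)) (_ * _),
    ← hbr]
  simp only [mul_assoc]

/-- The substantial case is `A g C g`. There `C` is expanded by the decomposition one level down, so
that `g C g` is either a conjugate `g C g⁻¹` of known form plus an element of `J`, or falls under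
the braid relation. -/
theorem span_D_mul_G {d n : ℕ} (ih : Submodule.span 𝕃 (D d n) = ⊤) {X : Y d (n + 2)}
    (hX : X ∈ Submodule.span 𝕃 (D d (n + 1))) :
    X * g d (n + 2) (n + 1) ∈ Submodule.span 𝕃 (D d (n + 1)) := by
  have left (A : Y d (n + 1)) {X : Y d (n + 2)} (hX : X ∈ Submodule.span 𝕃 (D d (n + 1))) :
      incl d (n + 1) A * X ∈ Submodule.span 𝕃 (D d (n + 1)) := by
    refine span_le_comap (LinearMap.mulLeft 𝕃 (incl d (n + 1) A)) ?_ hX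
    rintro _ (⟨W, a, rfl⟩ | ⟨W, a, rfl⟩ | ⟨hn, B, C, rfl⟩)
    · rw [LinearMap.mulLeft_apply, ← mul_assoc, ← map_mul]
      exact mem_span_D_T _ _
    · rw [LinearMap.mulLeft_apply, ← mul_assoc, ← map_mul]
      exact mem_span_D_B _ _
    · exact J_le_span_D (J_left A (mem_J _ _))
  refine span_le_comap (LinearMap.mulRight 𝕃 (g d (n + 2) (n + 1))) ?_ hX
  rintro _ (⟨W, a, rfl⟩ | ⟨W, a, rfl⟩ | ⟨hn, A, C, rfl⟩)
  · rw [LinearMap.mulRight_apply, mul_assoc, ← G_mul_incl_T, ← mul_assoc]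
    exact J_le_span_D (mem_J _ _)
  · rw [LinearMap.mulRight_apply, mul_assoc, mul_assoc, ← G_mul_incl_T, ← mul_assoc (bAt _ _ _),
      ← G_mul_incl_B, mul_assoc, ← map_mul, ← mul_assoc]
    exact J_le_span_D (mem_J _ _)
  · rw [LinearMap.mulRight_apply, mul_assoc, mul_assoc]
    refine left A ?_
    rw [← mul_assoc]
    have hsum (Z : Y d (n + 1)) : ud d • ∑ m ∈ Finset.range d,
        incl d (n + 1) (t d (n + 1) (n + 1) ^ (d - m)) * g d (n + 2) (n + 1)
          * incl d (n + 1) (Z * t d (n + 1) (n + 1) ^ m) ∈ Submodule.span 𝕃 (D d (n + 1)) :=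
      J_le_span_D (Submodule.smul_mem _ _ (Submodule.sum_mem _ fun m _ => mem_J _ _))
    refine span_le_comap ((LinearMap.mulLeftRight 𝕃 (g d (n + 2) (n + 1), g d (n + 2) (n + 1))).comp
      (incl d (n + 1)).toLinearMap) ?_ (ih ▸ Submodule.mem_top : C ∈ Submodule.span 𝕃 (D d n))
    rintro _ (⟨W, a, rfl⟩ | ⟨W, a, rfl⟩ | ⟨hn, A, C, rfl⟩)
    · simp only [LinearMap.comp_apply, AlgHom.toLinearMap_apply, LinearMap.mulLeftRight_apply]
      rw [map_mul, ← mul_assoc, G_incl_comm, mul_assoc, mul_assoc, ← mul_assoc (g d (n + 2) (n + 1)),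
        G_incl_G, G_T_inv]
      refine left _ (add_mem ?_ (hsum _))
      simpa using mem_span_D_T (d := d) (n := n + 1) 1 a
    · simp only [LinearMap.comp_apply, AlgHom.toLinearMap_apply, LinearMap.mulLeftRight_apply]
      rw [map_mul, ← mul_assoc, G_incl_comm, mul_assoc, mul_assoc, ← mul_assoc (g d (n + 2) (n + 1)),
        G_incl_G, G_BT_inv]
      refine left _ (add_mem ?_ (hsum _))
      simpa using mem_span_D_B (d := d) (n := n + 1) 1 a
    · obtain ⟨n, rfl⟩ : ∃ k, n = k + 1 := ⟨n - 1, by omega⟩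
      simp only [LinearMap.comp_apply, AlgHom.toLinearMap_apply, LinearMap.mulLeftRight_apply]
      rw [G_conj_g]
      exact J_le_span_D (mem_J _ _)

/-- The span contains `1`, so it is everything once it is stable under right multiplication by each
generator. -/
theorem span_D (d n : ℕ) : Submodule.span 𝕃 (D d n) = ⊤ := by
  have one_mem {n : ℕ} : (1 : Y d (n + 1)) ∈ Submodule.span 𝕃 (D d n) := by
    simpa using mem_span_D_T (d := d) (n := n) 1 0
  have top {n : ℕ} (h : ∀ h X : Y d (n + 1), X ∈ Submodule.span 𝕃 (D d n) →
      X * h ∈ Submodule.span 𝕃 (D d n)) : Submodule.span 𝕃 (D d n) = ⊤ :=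
    (Submodule.eq_top_iff').mpr fun X => by simpa using h X 1 one_mem
  induction n with
  | zero =>
    refine top fun h => ?_
    induction h using adjoin_induction with
    | hb h =>
      intro X hX
      refine span_le_comap (LinearMap.mulRight 𝕃 (b d 1)) ?_ hX
      rintro _ (⟨W, a, rfl⟩ | ⟨W, a, rfl⟩ | ⟨hn, A, C, rfl⟩)
      · rw [LinearMap.mulRight_apply, mul_assoc, ((t_b ⟨le_rfl, le_rfl⟩).pow_left a).eq]
        exact mem_span_D_B W a
      · rw [LinearMap.mulRight_apply, mul_assoc, mul_assoc, ((t_b ⟨le_rfl, le_rfl⟩).pow_left a).eq,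
          ← mul_assoc (bAt d 1 1)]
        simp only [bAt]
        rw [b_sq le_rfl]
        simp only [add_mul, one_mul, mul_add, smul_mul_assoc, mul_smul_comm, Finset.sum_mul,
          Finset.mul_sum]
        refine add_mem (mem_span_D_T W a) (Submodule.smul_mem _ _ (Submodule.smul_mem _ _
          (Submodule.sum_mem _ fun m _ => ?_)))
        rw [((t_b (d := d) (n := 1) (j := 1) ⟨le_rfl, le_rfl⟩).pow_left m).eq, mul_assoc, ← pow_add]
        exact mem_span_D_B W (m + a)
      · omega
    | hg i h => omega
    | ht j h =>
      obtain rfl : j = 1 := by omega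
      exact fun X => span_D_mul_T
    | hc c =>
      intro X hX
      rw [← Algebra.commutes, ← Algebra.smul_def]
      exact Submodule.smul_mem _ _ hX
    | hadd x y hx hy => exact fun X hX => by rw [mul_add]; exact add_mem (hx X hX) (hy X hX)
    | hmul x y hx hy => exact fun X hX => by rw [← mul_assoc]; exact hy _ (hx X hX)
  | succ n ih =>
    refine top fun h => ?_
    induction h using adjoin_induction with
    | hb h => rw [← incl_b (by omega)]; exact fun X => span_D_mul_incl _
    | hg i h =>
      rcases Nat.lt_or_ge i (n + 1) with hi | hi
      · rw [← incl_g ⟨h.1, by omega⟩]; exact fun X => span_D_mul_incl _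
      · obtain rfl : i = n + 1 := by omega
        exact fun X => span_D_mul_G ih
    | ht j h =>
      rcases Nat.lt_or_ge j (n + 2) with hi | hi
      · rw [← incl_t ⟨h.1, by omega⟩]; exact fun X => span_D_mul_incl _
      · obtain rfl : j = n + 2 := by omega
        exact fun X => span_D_mul_T
    | hc c =>
      intro X hX
      rw [← Algebra.commutes, ← Algebra.smul_def]
      exact Submodule.smul_mem _ _ hX
    | hadd x y hx hy => exact fun X hX => by rw [mul_add]; exact add_mem (hx X hX) (hy X hX)
    | hmul x y hx hy => exact fun X hX => by rw [← mul_assoc]; exact hy _ (hx X hX)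

/-- Scalars are absorbed into the coefficients from `Y_n`, so additivity is the only closure
property needed. -/
theorem succ_induction {d n : ℕ} {p : Y d (n + 1) → Prop}
    (hT : ∀ W a, p (incl d n W * t d (n + 1) (n + 1) ^ a))
    (hB : ∀ W a, p (incl d n W * (bAt d (n + 1) (n + 1) * t d (n + 1) (n + 1) ^ a)))
    (hG : 1 ≤ n → ∀ A C, p (incl d n A * g d (n + 1) n * incl d n C))
    (hadd : ∀ X X', p X → p X' → p (X + X')) (X : Y d (n + 1)) : p X := by
  have hX : X ∈ Submodule.span 𝕃 (D d n) := span_D d n ▸ Submodule.mem_top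
  refine (Submodule.closure_induction (p := fun X _ => p X) ?_ ?_ ?_ hX)
  · simpa using hT 0 0
  · exact fun X X' _ _ => hadd X X'
  · rintro c _ (⟨W, a, rfl⟩ | ⟨W, a, rfl⟩ | ⟨hn, A, C, rfl⟩)
    · simpa [smul_mul_assoc] using hT (c • W) a
    · simpa [smul_mul_assoc] using hB (c • W) a
    · simpa [smul_mul_assoc] using hG hn (c • A) C

/-! ### The representation on framed signed permutations -/

/-- Signed permutations of `Fin n` with a colour in `Fin d` at each position. -/
abbrev Word (d n : ℕ) : Type := Equiv.Perm (Fin n) × (Fin n → Bool) × (Fin n → Fin d)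

namespace Word
variable {d n : ℕ}

/-- The signed value at a position. -/
def key (w : Word d n) (i : Fin n) : ℤ := if w.2.1 i then (w.1 i : ℤ) + 1 else -((w.1 i : ℤ) + 1)

/-- The colour at a position. -/
def col (w : Word d n) (i : Fin n) : ℕ := w.2.2 i

/-- Permutation of positions. -/
def act (π : Equiv.Perm (Fin n)) (w : Word d n) : Word d n := (w.1 * π, w.2.1 ∘ π, w.2.2 ∘ π)

/-- Change of sign at a position. -/
def flip (i : Fin n) (w : Word d n) : Word d n := (w.1, Function.update w.2.1 i (!w.2.1 i), w.2.2)

@[simp] theorem key_act (π : Equiv.Perm (Fin n)) (w : Word d n) (i : Fin n) :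
    key (act π w) i = key w (π i) := rfl

@[simp] theorem col_act (π : Equiv.Perm (Fin n)) (w : Word d n) (i : Fin n) :
    col (act π w) i = col w (π i) := rfl

@[simp] theorem col_flip (w : Word d n) (i j : Fin n) : col (flip i w) j = col w j := rfl

@[simp] theorem key_flip_self (w : Word d n) (i : Fin n) : key (flip i w) i = -key w i := by
  simp only [key, flip, Function.update_self]
  cases w.2.1 i <;> simp

theorem key_flip_of_ne (w : Word d n) {i j : Fin n} (h : j ≠ i) : key (flip i w) j = key w j := by
  simp [key, flip, h]

theorem act_act (π ρ : Equiv.Perm (Fin n)) (w : Word d n) : act π (act ρ w) = act (ρ * π) w := rfl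

theorem act_one (w : Word d n) : act 1 w = w := rfl

theorem flip_flip (i : Fin n) (w : Word d n) : flip i (flip i w) = w := by
  obtain ⟨σ, s, c⟩ := w; simp [flip]

theorem flip_act (i : Fin n) (π : Equiv.Perm (Fin n)) (w : Word d n) :
    flip i (act π w) = act π (flip (π i) w) := by
  obtain ⟨σ, s, c⟩ := w
  simp only [flip, act, Prod.mk.injEq, true_and, and_true]
  ext j
  by_cases h : j = i
  · subst h; simp
  · simp [h]

theorem flip_comm (i j : Fin n) (w : Word d n) : flip i (flip j w) = flip j (flip i w) := by
  rcases eq_or_ne i j with rfl | h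
  · rfl
  · obtain ⟨σ, s, c⟩ := w
    simp [flip, h, h.symm, Function.update_comm h]

theorem key_ne_zero (w : Word d n) (i : Fin n) : key w i ≠ 0 := by
  unfold key; split_ifs <;> omega

theorem key_ne (w : Word d n) {i j : Fin n} (h : i ≠ j) :
    key w i ≠ key w j ∧ key w i ≠ -key w j := by
  have : (w.1 i : ℕ) ≠ w.1 j := fun h' => h (w.1.injective (Fin.ext h'))
  unfold key; split_ifs <;> omega

end Word

open Word

/-- The Hecke coefficient of two adjacent letters. -/
def al (c c' : ℕ) (x y : ℤ) : 𝕃 := if c = c' ∧ x < y then pu - pu⁻¹ else 0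

/-- The Hecke coefficient of the first letter. -/
def be (c : ℕ) (x : ℤ) : 𝕃 := if c = 0 ∧ 0 < x then pv - pv⁻¹ else 0

/-! ### Hecke operators of the generators and their relations -/

section Op
variable {d n : ℕ}

/-- The operator of a braid generator at two positions. -/
def opG (i j : Fin n) : Module.End 𝕃 (Word d n → 𝕃) where
  toFun F w := F (act (Equiv.swap i j) w) + al (col w i) (col w j) (key w i) (key w j) * F w
  map_add' F F' := by ext w; simp; ring
  map_smul' c F := by ext w; simp; ring

/-- The operator of the loop generator at a position. -/
def opB (i : Fin n) : Module.End 𝕃 (Word d n → 𝕃) where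
  toFun F w := F (flip i w) + be (col w i) (key w i) * F w
  map_add' F F' := by ext w; simp; ring
  map_smul' c F := by ext w; simp; ring

/-- The diagonal operator with eigenvalues `ζ^colour`. -/
def opT (ζ : 𝕃) (j : Fin n) : Module.End 𝕃 (Word d n → 𝕃) where
  toFun F w := ζ ^ col w j * F w
  map_add' F F' := by ext w; simp; ring
  map_smul' c F := by ext w; simp; ring

theorem opG_apply (i j : Fin n) (F : Word d n → 𝕃) (w : Word d n) : opG i j F w
    = F (act (Equiv.swap i j) w) + al (col w i) (col w j) (key w i) (key w j) * F w := rfl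

theorem opB_apply (i : Fin n) (F : Word d n → 𝕃) (w : Word d n) :
    opB i F w = F (flip i w) + be (col w i) (key w i) * F w := rfl

theorem opT_apply (ζ : 𝕃) (j : Fin n) (F : Word d n → 𝕃) (w : Word d n) :
    opT ζ j F w = ζ ^ col w j * F w := rfl

theorem opT_pow_apply (ζ : 𝕃) (j : Fin n) (m : ℕ) (F : Word d n → 𝕃) (w : Word d n) :
    (opT ζ j ^ m) F w = (ζ ^ col w j) ^ m * F w := by
  induction m generalizing F with
  | zero => simp
  | succ m ih => rw [pow_succ, Module.End.mul_apply, ih, opT_apply]; ring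

theorem opG_comm {i j k l : Fin n} (hik : i ≠ k) (hil : i ≠ l) (hjk : j ≠ k) (hjl : j ≠ l) :
    opG (d := d) i j * opG k l = opG k l * opG i j := by
  refine LinearMap.ext fun F => funext fun w => ?_
  have h : Equiv.swap i j * Equiv.swap k l = Equiv.swap k l * Equiv.swap i j := by
    refine (Equiv.Perm.disjoint_iff_eq_or_eq.mpr fun x => ?_).commute
    by_cases h1 : x = i
    · right; exact Equiv.swap_apply_of_ne_of_ne (h1 ▸ hik) (h1 ▸ hil)
    by_cases h2 : x = j
    · right; exact Equiv.swap_apply_of_ne_of_ne (h2 ▸ hjk) (h2 ▸ hjl)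
    · left; exact Equiv.swap_apply_of_ne_of_ne h1 h2
  simp only [Module.End.mul_apply, opG_apply, act_act, key_act, col_act, h,
    Equiv.swap_apply_of_ne_of_ne hik hil, Equiv.swap_apply_of_ne_of_ne hjk hjl,
    Equiv.swap_apply_of_ne_of_ne hik.symm hjk.symm, Equiv.swap_apply_of_ne_of_ne hil.symm hjl.symm]
  ring

/-- In the braid relation for `opG` these are the comparisons of coefficients at `s_{ij} w`, `s_{jk}
w` and `w`; the other terms match directly. Each holds by cases on the order of the keys and on
coincidences of colours. -/
theorem al_braid {c₁ c₂ c₃ : ℕ} {x y z : ℤ} (hxy : x ≠ y) (hyz : y ≠ z) (hxz : x ≠ z) :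
    al c₁ c₃ x z * al c₂ c₁ y x + al c₁ c₂ x y * al c₂ c₃ y z = al c₂ c₃ y z * al c₁ c₃ x z ∧
    al c₁ c₃ x z * al c₃ c₂ z y + al c₁ c₂ x y * al c₂ c₃ y z = al c₁ c₂ x y * al c₁ c₃ x z ∧
    al c₁ c₂ x y * al c₁ c₂ x y * al c₂ c₃ y z = al c₁ c₂ x y * (al c₂ c₃ y z * al c₂ c₃ y z) := by
  unfold al
  refine ⟨?_, ?_, ?_⟩ <;> split_ifs <;> first | omega | ring

theorem opG_braid {i j k : Fin n} (hij : i ≠ j) (hjk : j ≠ k) (hik : i ≠ k) :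
    opG (d := d) i j * opG j k * opG i j = opG j k * opG i j * opG j k := by
  refine LinearMap.ext fun F => funext fun w => ?_
  have h : Equiv.swap i j * Equiv.swap j k * Equiv.swap i j
      = Equiv.swap j k * Equiv.swap i j * Equiv.swap j k := by
    rw [Equiv.swap_mul_swap_mul_swap hij hik, Equiv.swap_comm i j, Equiv.swap_comm j k,
      Equiv.swap_mul_swap_mul_swap hjk.symm hik.symm, Equiv.swap_comm]
  obtain ⟨h1, h2, h3⟩ := al_braid (c₁ := col w i) (c₂ := col w j) (c₃ := col w k)
    (key_ne w hij).1 (key_ne w hjk).1 (key_ne w hik).1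
  simp only [Module.End.mul_apply, opG_apply, act_act, key_act, col_act, Equiv.swap_mul_self,
    act_one, h, Equiv.Perm.mul_apply, Equiv.swap_apply_left, Equiv.swap_apply_right,
    Equiv.swap_apply_of_ne_of_ne hij hik, Equiv.swap_apply_of_ne_of_ne hik.symm hjk.symm]
  linear_combination F (act (Equiv.swap i j) w) * h1 - F (act (Equiv.swap j k) w) * h2 + F w * h3

theorem opB_opG_comm {i j k : Fin n} (hij : i ≠ j) (hik : i ≠ k) :
    opB (d := d) i * opG j k = opG j k * opB i := by
  refine LinearMap.ext fun F => funext fun w => ?_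
  simp only [Module.End.mul_apply, opG_apply, opB_apply, key_act, col_act, col_flip, flip_act,
    Equiv.swap_apply_of_ne_of_ne hij hik, key_flip_of_ne w hij.symm, key_flip_of_ne w hik.symm]
  ring

/-- These compare coefficients in the relation `b g b g = g b g b`, one for each word where the two
sides do not match term by term. The conditions on `x`, `y` say that they are the keys of two
distinct positions. -/
theorem al_be_braid {c c' : ℕ} {x y : ℤ} (h1 : x ≠ y) (h2 : x ≠ -y) (h3 : x ≠ 0) (h4 : y ≠ 0) :
    al c' c (-y) (-x) = al c c' x y ∧ al c c' (-x) y = al c' c (-y) x ∧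
    be c' y + al c c' (-x) y * (be c (-x) * al c c' (-x) y) + be c x * al c c' x y * al c c' (-x) y
      = be c' y + al c c' x y * al c c' (-x) y * be c (-x) + al c c' x y * be c x * al c c' x y ∧
    be c' y * al c' c y (-x) + al c c' (-x) y * be c (-x) + be c x * al c c' x y
      = al c c' x y * be c' y ∧
    be c x * al c' c (-y) x
      = al c' c (-y) x * be c' (-y) + be c' y * al c' c y x + al c c' x y * be c x ∧
    be c x * be c' y * al c' c y x + be c x * al c c' x y * be c x
      = be c' y * al c' c y x * be c' y + al c c' x y * be c x * be c' y := by
  unfold al be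
  refine ⟨?_, ?_, ?_, ?_, ?_, ?_⟩ <;> split_ifs <;> first | omega | ring

theorem opB_opG_braid {i j : Fin n} (hij : i ≠ j) :
    opB (d := d) i * opG i j * opB i * opG i j = opG i j * opB i * opG i j * opB i := by
  refine LinearMap.ext fun F => funext fun w => ?_
  simp only [Module.End.mul_apply, opG_apply, opB_apply, key_act, col_act, col_flip, flip_act,
    Word.flip_flip, act_act, Equiv.swap_mul_self, act_one, Equiv.swap_apply_left, key_flip_self,
    Equiv.swap_apply_right, key_flip_of_ne _ hij, key_flip_of_ne _ hij.symm, flip_comm j i]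
  obtain ⟨h1, h2⟩ := key_ne w hij
  have h3 := key_ne_zero w i
  have h4 := key_ne_zero w j
  obtain ⟨e1, e2, e3, e4, e5, e6⟩ := al_be_braid (c := col w i) (c' := col w j) h1 h2 h3 h4
  linear_combination F (act (Equiv.swap i j) (Word.flip i (Word.flip j w))) * e1
    + F (act (Equiv.swap i j) w) * (e2 + e6) + F (Word.flip i w) * e3
    + F (act (Equiv.swap i j) (Word.flip i w)) * e4 + F (act (Equiv.swap i j) (Word.flip j w)) * e5

/-- Orthogonality of the characters of `ℤ/d`. It makes `e_i` act as the projection onto words with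
equal colours at two positions, and `f₁` as the projection onto colour `0`, which is why `al` and
`be` carry those conditions. -/
theorem sum_root_pow [NeZero d] {ζ : 𝕃} (hζ : IsPrimitiveRoot ζ d) {a c : ℕ} (ha : a < d)
    (hc : c < d) :
    (d : 𝕃)⁻¹ * ∑ m ∈ Finset.range d, (ζ ^ a) ^ m * (ζ ^ c) ^ (d - m) = if a = c then 1 else 0 := by
  have h0 : ζ ≠ 0 := hζ.ne_zero (NeZero.ne d)
  have hd : (d : 𝕃) ≠ 0 := NeZero.ne _
  have h1 (m : ℕ) (hm : m ∈ Finset.range d) :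
      (ζ ^ a) ^ m * (ζ ^ c) ^ (d - m) = (ζ ^ a / ζ ^ c) ^ m := by
    rw [pow_sub₀ _ (pow_ne_zero _ h0) (Finset.mem_range.mp hm).le, ← pow_mul ζ c d, mul_comm c d,
      pow_mul, hζ.pow_eq_one, one_pow, one_mul, div_pow, div_eq_mul_inv]
  rw [Finset.sum_congr rfl h1]
  split_ifs with hac
  · rw [hac, div_self (pow_ne_zero _ h0)]; simp [hd]
  · have hne : ζ ^ a / ζ ^ c ≠ 1 := by
      rw [Ne, div_eq_one_iff_eq (pow_ne_zero _ h0)]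
      exact fun h => hac (hζ.pow_inj ha hc h)
    rw [geom_sum_eq hne, div_pow, ← pow_mul, ← pow_mul, mul_comm a, mul_comm c, pow_mul, pow_mul,
      hζ.pow_eq_one]
    simp

theorem opE_apply [NeZero d] {ζ : 𝕃} (hζ : IsPrimitiveRoot ζ d) (i j : Fin n) (F : Word d n → 𝕃)
    (w : Word d n) :
    ((d : 𝕃)⁻¹ • ∑ m ∈ Finset.range d, opT ζ i ^ m * opT ζ j ^ (d - m) :
      Module.End 𝕃 (Word d n → 𝕃)) F w
      = if col w i = col w j then F w else 0 := by
  have := sum_root_pow hζ (w.2.2 i).2 (w.2.2 j).2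
  simp only [LinearMap.smul_apply, LinearMap.sum_apply, Module.End.mul_apply, Pi.smul_apply,
    Finset.sum_apply, opT_pow_apply, ← mul_assoc, smul_eq_mul, ← Finset.sum_mul]
  rw [show col w i = (w.2.2 i : ℕ) from rfl, show col w j = (w.2.2 j : ℕ) from rfl, this]
  split_ifs <;> simp

theorem opF_apply [NeZero d] {ζ : 𝕃} (hζ : IsPrimitiveRoot ζ d) (i : Fin n) (F : Word d n → 𝕃)
    (w : Word d n) :
    ((d : 𝕃)⁻¹ • ∑ m ∈ Finset.range d, opT ζ i ^ m : Module.End 𝕃 (Word d n → 𝕃)) F w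
      = if col w i = 0 then F w else 0 := by
  have := sum_root_pow hζ (w.2.2 i).2 (NeZero.pos d)
  simp only [LinearMap.smul_apply, LinearMap.sum_apply, Pi.smul_apply,
    Finset.sum_apply, opT_pow_apply, ← mul_assoc, smul_eq_mul, ← Finset.sum_mul]
  simp only [pow_zero, one_pow, mul_one] at this
  rw [show col w i = (w.2.2 i : ℕ) from rfl, this]
  split_ifs <;> simp

theorem opG_sq [NeZero d] {ζ : 𝕃} (hζ : IsPrimitiveRoot ζ d) {i j : Fin n} (hij : i ≠ j) :
    opG (d := d) i j ^ 2 = 1 + (pu - pu⁻¹) •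
      (((d : 𝕃)⁻¹ • ∑ m ∈ Finset.range d, opT ζ i ^ m * opT ζ j ^ (d - m)) * opG i j) := by
  refine LinearMap.ext fun F => funext fun w => ?_
  rw [pow_two, Module.End.mul_apply, LinearMap.add_apply, LinearMap.smul_apply,
    Module.End.mul_apply, Pi.add_apply, Pi.smul_apply, opE_apply hζ]
  simp only [opG_apply, act_act, key_act, col_act, Equiv.swap_mul_self, act_one,
    Equiv.swap_apply_left, Equiv.swap_apply_right, Module.End.one_apply, smul_eq_mul]
  have h := (key_ne w hij).1
  unfold al
  split_ifs <;> first | omega | ring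

theorem opB_sq [NeZero d] {ζ : 𝕃} (hζ : IsPrimitiveRoot ζ d) (i : Fin n) :
    opB (d := d) i ^ 2 = 1 + (pv - pv⁻¹) •
      (((d : 𝕃)⁻¹ • ∑ m ∈ Finset.range d, opT ζ i ^ m) * opB i) := by
  refine LinearMap.ext fun F => funext fun w => ?_
  rw [pow_two, Module.End.mul_apply, LinearMap.add_apply, LinearMap.smul_apply,
    Module.End.mul_apply, Pi.add_apply, Pi.smul_apply, opF_apply hζ]
  simp only [opB_apply, Word.flip_flip, col_flip, key_flip_self, Module.End.one_apply, smul_eq_mul]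
  have h := key_ne_zero w i
  unfold be
  split_ifs <;> first | omega | ring

theorem opT_comm (ζ : 𝕃) (i j : Fin n) : opT (d := d) ζ i * opT ζ j = opT ζ j * opT ζ i := by
  refine LinearMap.ext fun F => funext fun w => ?_
  simp only [Module.End.mul_apply, opT_apply]
  ring

theorem opT_opB_comm (ζ : 𝕃) (i j : Fin n) : opT (d := d) ζ i * opB j = opB j * opT ζ i := by
  refine LinearMap.ext fun F => funext fun w => ?_
  simp only [Module.End.mul_apply, opT_apply, opB_apply, col_flip]
  ring

theorem opT_opG (ζ : 𝕃) (i j k : Fin n) :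
    opT (d := d) ζ k * opG i j = opG i j * opT ζ (Equiv.swap i j k) := by
  refine LinearMap.ext fun F => funext fun w => ?_
  simp only [Module.End.mul_apply, opT_apply, opG_apply, col_act, Equiv.swap_apply_self]
  have : al (col w i) (col w j) (key w i) (key w j) * ζ ^ col w (Equiv.swap i j k)
      = al (col w i) (col w j) (key w i) (key w j) * ζ ^ col w k := by
    unfold al
    split_ifs with h
    · rw [Equiv.swap_apply_def]
      split_ifs with h1 h2
      · rw [h1, h.1]
      · rw [h2, h.1]
      · rfl
    · simp
  linear_combination -F w * this

theorem opT_pow {ζ : 𝕃} (hζ : IsPrimitiveRoot ζ d) (i : Fin n) : opT (d := d) ζ i ^ d = 1 := by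
  refine LinearMap.ext fun F => funext fun w => ?_
  rw [opT_pow_apply, ← pow_mul, mul_comm (col w i), pow_mul, hζ.pow_eq_one, one_pow, one_mul]
  rfl

/-- The operators of the generators; `tⱼ` acts at position `j - 1`. -/
def opGen (ζ : 𝕃) : Gen n → Module.End 𝕃 (Word d n → 𝕃)
  | .b h => opB ⟨0, h⟩
  | .g i h => opG ⟨i - 1, by omega⟩ ⟨i, by omega⟩
  | .t j h => opT ζ ⟨j - 1, by omega⟩

theorem lift_opGen_fb (ζ : 𝕃) (h : 1 ≤ n) :
    FreeAlgebra.lift 𝕃 (opGen (d := d) ζ) (fb n) = opB ⟨0, h⟩ := by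
  simp [fb, h, opGen]

theorem lift_opGen_fg (ζ : 𝕃) {i : ℕ} (h : 1 ≤ i ∧ i + 1 ≤ n) :
    FreeAlgebra.lift 𝕃 (opGen (d := d) ζ) (fg n i)
      = opG ⟨i - 1, by omega⟩ ⟨i, by omega⟩ := by
  simp [fg, h, opGen]

theorem lift_opGen_ft (ζ : 𝕃) {j : ℕ} (h : 1 ≤ j ∧ j ≤ n) :
    FreeAlgebra.lift 𝕃 (opGen (d := d) ζ) (ft n j) = opT ζ ⟨j - 1, by omega⟩ := by
  simp [ft, h, opGen]

theorem lift_opGen_rel [NeZero d] {ζ : 𝕃} (hζ : IsPrimitiveRoot ζ d) {p q : Free n}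
    (h : Rel d n p q) : FreeAlgebra.lift 𝕃 (opGen (d := d) ζ) p
      = FreeAlgebra.lift 𝕃 (opGen (d := d) ζ) q := by
  induction h with
  | g_comm i j hi hj hij =>
    simp only [map_mul, lift_opGen_fg ζ hi, lift_opGen_fg ζ hj]
    apply opG_comm <;> simp only [ne_eq, Fin.mk.injEq] <;> omega
  | g_braid i j hi hj hij =>
    simp only [map_mul, lift_opGen_fg ζ hi, lift_opGen_fg ζ hj]
    rcases hij with rfl | rfl
    · apply opG_braid <;> simp only [ne_eq, Fin.mk.injEq] <;> omega
    · symm; apply opG_braid <;> simp only [ne_eq, Fin.mk.injEq] <;> omega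
  | b_g_comm i hi hi1 =>
    simp only [map_mul, lift_opGen_fg ζ hi, lift_opGen_fb ζ (show 1 ≤ n by omega)]
    apply opB_opG_comm <;> simp only [ne_eq, Fin.mk.injEq] <;> omega
  | b_g_braid hn =>
    simp only [map_mul, lift_opGen_fg ζ ⟨le_rfl, hn⟩, lift_opGen_fb ζ (show 1 ≤ n by omega)]
    apply opB_opG_braid; simp
  | t_comm i j hi hj =>
    simp only [map_mul, lift_opGen_ft ζ hi, lift_opGen_ft ζ hj]
    apply opT_comm
  | t_g i j hi hj =>
    simp only [map_mul, lift_opGen_fg ζ hi, lift_opGen_ft ζ hj, lift_opGen_ft ζ (swap_range hi hj)]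
    rw [opT_opG]
    congr 2
    simp only [Equiv.swap_apply_def, Fin.mk.injEq]
    split_ifs <;> simp only [Fin.mk.injEq] <;> omega
  | t_b j hj =>
    simp only [map_mul, lift_opGen_ft ζ hj, lift_opGen_fb ζ (show 1 ≤ n by omega)]
    apply opT_opB_comm
  | t_pow j hj =>
    simp only [map_pow, map_one, lift_opGen_ft ζ hj, opT_pow hζ]
  | g_sq i hi =>
    simp only [map_pow, map_mul, map_add, map_one, map_smul, fe, map_sum, lift_opGen_fg ζ hi,
      lift_opGen_ft ζ (show 1 ≤ i ∧ i ≤ n by omega),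
      lift_opGen_ft ζ (show 1 ≤ i + 1 ∧ i + 1 ≤ n by omega)]
    apply opG_sq hζ; simp only [ne_eq, Fin.mk.injEq]; omega
  | b_sq hn =>
    simp only [map_pow, map_mul, map_add, map_one, map_smul, ff, map_sum, lift_opGen_fb ζ hn,
      lift_opGen_ft ζ (j := 1) ⟨le_rfl, hn⟩]
    apply opB_sq hζ

/-- The representation of `Y_{d,n}^B` on functions on framed signed permutations. -/
def rep [NeZero d] {ζ : 𝕃} (hζ : IsPrimitiveRoot ζ d) (n : ℕ) :
    Y d n →ₐ[𝕃] Module.End 𝕃 (Word d n → 𝕃) :=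
  RingQuot.liftAlgHom 𝕃 ⟨FreeAlgebra.lift 𝕃 (opGen ζ), fun _ _ h => lift_opGen_rel hζ h⟩

theorem rep_proj [NeZero d] {ζ : 𝕃} (hζ : IsPrimitiveRoot ζ d) (f : Free n) :
    rep hζ n (proj d n f) = FreeAlgebra.lift 𝕃 (opGen ζ) f :=
  RingQuot.liftAlgHom_mkAlgHom_apply 𝕃 (FreeAlgebra.lift 𝕃 (opGen ζ))
    (fun _ _ h => lift_opGen_rel hζ h) f

end Op

open Word

/-! ### Cyclicity of `vac` and the lower bound for the dimension -/

section Cyclic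
variable {d n : ℕ} [NeZero d] {ζ : 𝕃} (hζ : IsPrimitiveRoot ζ d)

/-- The indicator of the words with trivial underlying signed permutation. -/
def vac (d n : ℕ) : Word d n → 𝕃 := fun w => if w.1 = 1 ∧ w.2.1 = fun _ => true then 1 else 0

/-- The action on `vac`. -/
def orbit (n : ℕ) : Y d n →ₗ[𝕃] (Word d n → 𝕃) :=
  (LinearMap.applyₗ (vac d n)).comp (rep hζ n).toLinearMap

theorem rep_mem_range (y : Y d n) {F : Word d n → 𝕃} (hF : F ∈ LinearMap.range (orbit hζ n)) :
    rep hζ n y F ∈ LinearMap.range (orbit hζ n) := by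
  obtain ⟨x, rfl⟩ := hF
  exact ⟨y * x, by simp [orbit]⟩

theorem opG_mem_range (i : ℕ) (hi : i + 1 < n) {F : Word d n → 𝕃}
    (hF : F ∈ LinearMap.range (orbit hζ n)) :
    opG ⟨i, by omega⟩ ⟨i + 1, hi⟩ F ∈ LinearMap.range (orbit hζ n) := by
  have := rep_mem_range hζ (g d n (i + 1)) hF
  rwa [g, rep_proj, lift_opGen_fg ζ ⟨by omega, by omega⟩] at this

theorem opB_mem_range (hn : 0 < n) {F : Word d n → 𝕃} (hF : F ∈ LinearMap.range (orbit hζ n)) :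
    opB ⟨0, hn⟩ F ∈ LinearMap.range (orbit hζ n) := by
  have := rep_mem_range hζ (b d n) hF
  rwa [b, rep_proj, lift_opGen_fb ζ hn] at this

theorem opT_pow_mem_range (j : Fin n) (m : ℕ) {F : Word d n → 𝕃}
    (hF : F ∈ LinearMap.range (orbit hζ n)) :
    (opT ζ j ^ m) F ∈ LinearMap.range (orbit hζ n) := by
  have := rep_mem_range hζ (t d n (j + 1) ^ m) hF
  rwa [map_pow, t, rep_proj, lift_opGen_ft ζ ⟨by omega, by omega⟩] at this

/-- Fourier inversion over `ℤ/d`: the projection onto one colour at one position is a combination of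
powers of the framing operator. -/
theorem colour_mem_range (j : Fin n) (c : Fin d) {F : Word d n → 𝕃}
    (hF : F ∈ LinearMap.range (orbit hζ n)) :
    (fun w => if w.2.2 j = c then F w else 0) ∈ LinearMap.range (orbit hζ n) := by
  have h : (fun w => if w.2.2 j = c then F w else 0) = (d : 𝕃)⁻¹ • ∑ m ∈ Finset.range d,
      (ζ ^ (c : ℕ)) ^ (d - m) • (opT ζ j ^ m) F := by
    funext w
    have := sum_root_pow hζ (w.2.2 j).2 c.2
    simp only [Pi.smul_apply, Finset.sum_apply, opT_pow_apply, smul_eq_mul]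
    rw [Finset.sum_congr rfl fun m _ => show _ = (ζ ^ (w.2.2 j : ℕ)) ^ m * (ζ ^ (c : ℕ)) ^ (d - m) * F w by
      simp only [col]; ring, ← Finset.sum_mul, ← mul_assoc, this]
    simp only [Fin.ext_iff]
    split_ifs <;> simp
  rw [h]
  exact Submodule.smul_mem _ _ (Submodule.sum_mem _ fun m _ => Submodule.smul_mem _ _
    (opT_pow_mem_range hζ j m hF))

/-- `vac` ignores colours, so cutting it by the colour projections at all positions isolates a
single word. -/
theorem single_one_mem_range (c : Fin n → Fin d) :
    Pi.single ((1, fun _ => true, c) : Word d n) 1 ∈ LinearMap.range (orbit hζ n) := by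
  have h (s : Finset (Fin n)) : (fun w : Word d n => if ∀ j ∈ s, w.2.2 j = c j then vac d n w else 0)
      ∈ LinearMap.range (orbit hζ n) := by
    induction s using Finset.induction_on with
    | empty => exact ⟨1, by simp [orbit]⟩
    | insert j s hj ih =>
      convert colour_mem_range hζ j (c j) ih using 2 with w
      simp only [Finset.forall_mem_insert, ite_and]
  convert h Finset.univ using 1
  funext w
  obtain ⟨σ, s, c'⟩ := w
  simp only [Pi.single_apply, vac, Prod.mk.injEq, Finset.mem_univ, true_implies, ← funext_iff (f := c'),
    ← ite_and]
  congr 1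
  exact propext (by tauto)

/-- `opG` sends a point mass to the point mass at the swapped word plus a multiple of the original
one, and the latter can be subtracted. -/
theorem single_act_swap_mem_range (i : ℕ) (hi : i + 1 < n) {w : Word d n}
    (hw : Pi.single w 1 ∈ LinearMap.range (orbit hζ n)) :
    Pi.single (act (Equiv.swap ⟨i, by omega⟩ ⟨i + 1, hi⟩) w) 1 ∈ LinearMap.range (orbit hζ n) := by
  set i' : Fin n := ⟨i, by omega⟩
  set j' : Fin n := ⟨i + 1, hi⟩
  have h : Pi.single (act (Equiv.swap i' j') w) 1 = opG i' j' (Pi.single w 1)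
      - al (col w i') (col w j') (key w i') (key w j') • (Pi.single w 1 : Word d n → 𝕃) := by
    funext x
    have hx : act (Equiv.swap i' j') x = w ↔ x = act (Equiv.swap i' j') w := by
      constructor <;> rintro rfl <;> simp [act_act, act_one]
    simp only [Pi.sub_apply, Pi.smul_apply, opG_apply, Pi.single_apply, smul_eq_mul, hx]
    by_cases h : x = w
    · rw [h]; ring
    · simp [h]
  rw [h]
  exact Submodule.sub_mem _ (opG_mem_range hζ i hi hw) (Submodule.smul_mem _ _ hw)

theorem single_flip_zero_mem_range (hn : 0 < n) {w : Word d n}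
    (hw : Pi.single w 1 ∈ LinearMap.range (orbit hζ n)) :
    Pi.single (Word.flip ⟨0, hn⟩ w) 1 ∈ LinearMap.range (orbit hζ n) := by
  set i' : Fin n := ⟨0, hn⟩
  have h : Pi.single (Word.flip i' w) 1 = opB i' (Pi.single w 1)
      - be (col w i') (key w i') • (Pi.single w 1 : Word d n → 𝕃) := by
    funext x
    have hx : Word.flip i' x = w ↔ x = Word.flip i' w := by
      constructor <;> rintro rfl <;> simp [Word.flip_flip]
    simp only [Pi.sub_apply, Pi.smul_apply, opB_apply, Pi.single_apply, smul_eq_mul, hx]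
    by_cases h : x = w
    · rw [h]; ring
    · simp [h]
  rw [h]
  exact Submodule.sub_mem _ (opB_mem_range hζ hn hw) (Submodule.smul_mem _ _ hw)

theorem single_act_mem_range (π : Equiv.Perm (Fin n)) {w : Word d n}
    (hw : Pi.single w 1 ∈ LinearMap.range (orbit hζ n)) :
    Pi.single (act π w) 1 ∈ LinearMap.range (orbit hζ n) := by
  rcases n with _ | n
  · rwa [Subsingleton.elim π 1, act_one]
  have hπ : π ∈ Submonoid.closure
      (Set.range fun i : Fin n => Equiv.swap i.castSucc i.succ) := by
    rw [Equiv.Perm.mclosure_swap_castSucc_succ]; trivial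
  induction hπ using Submonoid.closure_induction generalizing w with
  | mem _ h =>
    obtain ⟨i, rfl⟩ := h
    exact single_act_swap_mem_range hζ i (by omega) hw
  | one => rwa [act_one]
  | mul x y _ _ hx hy => rw [← act_act]; exact hy (hx hw)

theorem single_flip_mem_range (i : Fin n) {w : Word d n}
    (hw : Pi.single w 1 ∈ LinearMap.range (orbit hζ n)) :
    Pi.single (Word.flip i w) 1 ∈ LinearMap.range (orbit hζ n) := by
  have hn : 0 < n := i.pos
  have := single_act_mem_range hζ (Equiv.swap ⟨0, hn⟩ i)
    (single_flip_zero_mem_range hζ hn (single_act_mem_range hζ (Equiv.swap ⟨0, hn⟩ i) hw))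
  rwa [flip_act, act_act, Equiv.swap_mul_self, act_one, Equiv.swap_apply_left] at this

theorem single_mem_range (w : Word d n) : Pi.single w 1 ∈ LinearMap.range (orbit hζ n) := by
  obtain ⟨σ, s, c⟩ := w
  -- `S` is the set of positions with sign `false`. The induction flips them one at a time, starting
  -- from the permuted all-positive word.
  have h (S : Finset (Fin n)) :
      Pi.single ((σ, fun i => decide (i ∉ S), c) : Word d n) 1 ∈ LinearMap.range (orbit hζ n) := by
    induction S using Finset.induction_on with
    | empty =>
      have := single_act_mem_range hζ σ (single_one_mem_range hζ (c ∘ σ.symm))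
      convert this using 2
      simp only [act, one_mul, Prod.mk.injEq, true_and]
      exact ⟨by ext; simp, by ext; simp⟩
    | insert j S hj ih =>
      have := single_flip_mem_range hζ j ih
      convert this using 2
      simp only [Word.flip, Prod.mk.injEq, true_and, and_true]
      funext i
      by_cases hij : i = j
      · subst hij; simp [hj]
      · simp [hij]
  convert h (Finset.univ.filter fun i => s i = false) using 4 with i
  simp

theorem orbit_surjective : Function.Surjective (orbit hζ n) := by
  rw [← LinearMap.range_eq_top, Submodule.eq_top_iff']
  intro F
  rw [← Finset.univ_sum_single F]
  refine Submodule.sum_mem _ fun w _ => ?_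
  have := Submodule.smul_mem _ (F w) (single_mem_range hζ w)
  rwa [← Pi.single_smul, smul_eq_mul, mul_one] at this

end Cyclic

theorem exists_primitiveRoot (d : ℕ) [NeZero d] : ∃ ζ : 𝕃, IsPrimitiveRoot ζ d :=
  ⟨algebraMap ℂ 𝕃 _, (Complex.isPrimitiveRoot_exp d (NeZero.ne d)).map_of_injective
    (algebraMap ℂ 𝕃).injective⟩

theorem card_le_finrank (d n : ℕ) [NeZero d] [FiniteDimensional 𝕃 (Y d n)] :
    n.factorial * (2 * d) ^ n ≤ Module.finrank 𝕃 (Y d n) := by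
  obtain ⟨ζ, hζ⟩ := exists_primitiveRoot d
  have := LinearMap.finrank_le_finrank_of_surjective (orbit_surjective (n := n) hζ)
  rw [Module.finrank_fintype_fun_eq_card] at this
  simpa [Fintype.card_perm, mul_pow] using this

/-! ### Freeness of `Y_{n+1}` over `Y_n` and the basis `C_n` -/

/-- Indices of the elements of `M_{d,n+1}`. -/
abbrev Idx (d n : ℕ) : Type := Bool × Fin (n + 1) × Fin d

/-- The elements of `M_{d,n+1}`. -/
def mIdx {d n : ℕ} (i : Idx d n) : Y d (n + 1) := mElt d (n + 1) i.1 (i.2.1 + 1) i.2.2 (n + 1)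

/-- The combinations of the elements of `M_{d,n+1}` with coefficients in `Y_n`. -/
def comb (d n : ℕ) : (Idx d n → Y d n) →ₗ[𝕃] Y d (n + 1) :=
  ∑ i, (LinearMap.mulRight 𝕃 (mIdx i)).comp ((incl d n).toLinearMap.comp (LinearMap.proj i))

theorem comb_apply {d n : ℕ} (f : Idx d n → Y d n) : comb d n f = ∑ i, incl d n (f i) * mIdx i := by
  simp [comb]

theorem comb_single {d n : ℕ} (i : Idx d n) (W : Y d n) :
    comb d n (Pi.single i W) = incl d n W * mIdx i := by
  rw [comb_apply, Finset.sum_eq_single i]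
  · simp
  · intro j _ hj; simp [hj]
  · simp

theorem comb_mul {d n : ℕ} (f : Idx d n → Y d n) (W : Y d n) :
    comb d n (fun i => W * f i) = incl d n W * comb d n f := by
  simp only [comb_apply, Finset.mul_sum, map_mul, mul_assoc]

theorem mIdx_mem_M {d n : ℕ} (i : Idx d n) : mIdx i ∈ M d (n + 1) (n + 1) :=
  ⟨i.1, i.2.1 + 1, i.2.2, by omega, by omega, i.2.2.2, rfl⟩

theorem exists_mIdx {d n : ℕ} {m : Y d (n + 1)} (hm : m ∈ M d (n + 1) (n + 1)) :
    ∃ i : Idx d n, m = mIdx i := by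
  obtain ⟨s, j, a, h1, h2, h3, rfl⟩ := hm
  obtain ⟨j, rfl⟩ : ∃ k, j = k + 1 := ⟨j - 1, by omega⟩
  exact ⟨(s, ⟨j, by omega⟩, ⟨a, h3⟩), rfl⟩

theorem mIdx_last {d n : ℕ} (s : Bool) (a : Fin d) : mIdx (n := n) (s, Fin.last n, a)
    = if s then bAt d (n + 1) (n + 1) * t d (n + 1) (n + 1) ^ (a : ℕ)
      else t d (n + 1) (n + 1) ^ (a : ℕ) :=
  mElt_self _ _

theorem g_mul_mIdx {d n : ℕ} (i : Idx d n) : g d (n + 2) (n + 1) * incl d (n + 1) (mIdx i)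
    = mIdx (n := n + 1) (i.1, i.2.1.castSucc, i.2.2) := by
  have h : mIdx (n := n + 1) (i.1, i.2.1.castSucc, i.2.2)
      = mElt d (n + 2) i.1 (i.2.1 + 1) i.2.2 (n + 1 + 1) := rfl
  rw [h, mIdx, incl_mElt _ _ (by omega) (by omega) le_rfl, mElt_succ (k := n + 1) _ _ (by omega)]

theorem t_pow_mod {d n j : ℕ} (hj : 1 ≤ j ∧ j ≤ n) (a : ℕ) : t d n j ^ (a % d) = t d n j ^ a := by
  conv_rhs => rw [← Nat.mod_add_div a d, pow_add, pow_mul, t_pow_d d n j hj, one_pow, mul_one]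

/-- In `A g C` the factor `C` is a combination of `w m` with `m` in the preceding `M`. The
coefficient `w` commutes with `g`, and `g m` lies in the next `M`. -/
theorem comb_surjective (d n : ℕ) [NeZero d] : Function.Surjective (comb d n) := by
  have mem {n : ℕ} (i : Idx d n) (W : Y d n) : incl d n W * mIdx i ∈ LinearMap.range (comb d n) :=
    ⟨_, comb_single i W⟩
  have memT {n : ℕ} (s : Bool) (W : Y d n) (a : ℕ) : incl d n W *
      (if s then bAt d (n + 1) (n + 1) * t d (n + 1) (n + 1) ^ a else t d (n + 1) (n + 1) ^ a)
      ∈ LinearMap.range (comb d n) := by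
    have := mem (s, Fin.last n, ⟨a % d, Nat.mod_lt _ (NeZero.pos d)⟩) W
    rwa [mIdx_last, t_pow_mod ⟨by omega, le_rfl⟩] at this
  rw [← LinearMap.range_eq_top]
  induction n with
  | zero =>
    refine (Submodule.eq_top_iff').mpr fun X => ?_
    induction X using succ_induction with
    | hT W a => exact memT false W a
    | hB W a => exact memT true W a
    | hG h => omega
    | hadd X X' h h' => exact add_mem h h'
  | succ n ih =>
    refine (Submodule.eq_top_iff').mpr fun X => ?_
    induction X using succ_induction with
    | hT W a => exact memT false W a
    | hB W a => exact memT true W a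
    | hG _ A C =>
      obtain ⟨f, rfl⟩ : C ∈ LinearMap.range (comb d n) := ih ▸ Submodule.mem_top
      rw [comb_apply, map_sum, Finset.mul_sum]
      refine Submodule.sum_mem _ fun i _ => ?_
      rw [map_mul, mul_assoc, ← mul_assoc (g _ _ _), G_incl_comm, mul_assoc (incl _ _ (incl _ _ _)),
        g_mul_mIdx, ← mul_assoc, ← map_mul]
      exact mem _ _
    | hadd X X' h h' => exact add_mem h h'

instance finiteDimensional_Y (d n : ℕ) [NeZero d] : FiniteDimensional 𝕃 (Y d n) := by
  induction n with
  | zero =>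
    exact Module.Finite.equiv
      (LinearEquiv.ofBijective (ground d).toLinearMap (ground_bijective d)).symm
  | succ n ih => exact Module.Finite.of_surjective (comb d n) (comb_surjective d n)

/-- `comb_surjective` gives the upper bound by induction, the cyclic representation the lower one.
-/
theorem finrank_Y (d n : ℕ) [NeZero d] : Module.finrank 𝕃 (Y d n) = n.factorial * (2 * d) ^ n := by
  refine le_antisymm ?_ (card_le_finrank d n)
  induction n with
  | zero =>
    rw [(LinearEquiv.ofBijective (ground d).toLinearMap (ground_bijective d)).finrank_eq]
    simp
  | succ n ih =>
    refine (LinearMap.finrank_le_finrank_of_surjective (comb_surjective d n)).trans ?_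
    rw [Module.finrank_pi_fintype]
    simp only [Finset.sum_const, Finset.card_univ, smul_eq_mul, Fintype.card_prod, Fintype.card_bool,
      Fintype.card_fin]
    calc 2 * ((n + 1) * d) * Module.finrank 𝕃 (Y d n)
        ≤ 2 * ((n + 1) * d) * (n.factorial * (2 * d) ^ n) := Nat.mul_le_mul_left _ ih
      _ = (n + 1).factorial * (2 * d) ^ (n + 1) := by rw [Nat.factorial_succ, pow_succ]; ring

theorem comb_bijective (d n : ℕ) [NeZero d] : Function.Bijective (comb d n) := by
  refine ⟨(LinearMap.injective_iff_surjective_of_finrank_eq_finrank ?_).mpr (comb_surjective d n),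
    comb_surjective d n⟩
  rw [Module.finrank_pi_fintype, finrank_Y]
  simp only [finrank_Y, Finset.sum_const, Finset.card_univ, smul_eq_mul, Fintype.card_prod,
    Fintype.card_bool, Fintype.card_fin]
  rw [Nat.factorial_succ, pow_succ]; ring

theorem span_C (d n : ℕ) [NeZero d] : Submodule.span 𝕃 (C d n) = ⊤ := by
  induction n with
  | zero =>
    refine (Submodule.eq_top_iff').mpr fun X => ?_
    refine Submodule.mem_span_singleton.mpr ⟨ground d X, (ground_bijective d).1 ?_⟩
    simp
  | succ n ih =>
    refine (Submodule.eq_top_iff').mpr fun X => ?_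
    obtain ⟨f, rfl⟩ := comb_surjective d n X
    rw [comb_apply]
    refine Submodule.sum_mem _ fun i _ => ?_
    refine span_le_comap ((LinearMap.mulRight 𝕃 (mIdx i)).comp (incl d n).toLinearMap) ?_
      (ih ▸ Submodule.mem_top : f i ∈ Submodule.span 𝕃 (C d n))
    intro w hw
    exact Submodule.subset_span ⟨w, hw, mIdx i, mIdx_mem_M i, rfl⟩

theorem C_finite_card (d n : ℕ) : (C d n).Finite ∧ (C d n).ncard ≤ n.factorial * (2 * d) ^ n := by
  induction n with
  | zero => simp [C]
  | succ n ih =>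
    have h : C d (n + 1) ⊆ (fun p : Y d n × Idx d n => incl d n p.1 * mIdx p.2) ''
        (C d n ×ˢ Set.univ) := by
      rintro _ ⟨w, hw, m, hm, rfl⟩
      obtain ⟨i, rfl⟩ := exists_mIdx hm
      exact ⟨(w, i), ⟨hw, trivial⟩, rfl⟩
    have hf : (C d n ×ˢ (Set.univ : Set (Idx d n))).Finite := ih.1.prod Set.finite_univ
    refine ⟨(hf.image _).subset h, (Set.ncard_le_ncard h (hf.image _)).trans
      ((Set.ncard_image_le hf).trans ?_)⟩
    rw [Set.ncard_prod, Set.ncard_univ, Nat.card_eq_fintype_card]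
    simp only [Fintype.card_prod, Fintype.card_bool, Fintype.card_fin]
    calc (C d n).ncard * (2 * ((n + 1) * d))
        ≤ n.factorial * (2 * d) ^ n * (2 * ((n + 1) * d)) := Nat.mul_le_mul_right _ ih.2
      _ = (n + 1).factorial * (2 * d) ^ (n + 1) := by rw [Nat.factorial_succ, pow_succ]; ring

/-- A spanning set with at most `dim Y_n` elements is independent. Distinctness of the products need
not be known beforehand, since only an upper bound for the cardinality of `C_n` enters. -/
theorem linearIndepOn_C (d n : ℕ) [NeZero d] : LinearIndepOn 𝕃 id (C d n) := by
  obtain ⟨hf, hc⟩ := C_finite_card d n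
  have := hf.fintype
  have hs : ⊤ ≤ Submodule.span 𝕃 (Set.range (Subtype.val : C d n → Y d n)) := by
    rw [Subtype.range_coe, span_C]
  refine linearIndependent_of_top_le_span_of_card_eq_finrank hs (le_antisymm ?_ ?_)
  · rw [← Nat.card_eq_fintype_card, finrank_Y]; exact hc
  · have := finrank_range_le_card (R := 𝕃) (Subtype.val : C d n → Y d n)
    rwa [Set.finrank, top_le_iff.mp hs, finrank_top] at this

/-! ### The relative traces -/

section Trace
variable {d : ℕ} [NeZero d] (x y : Fin d → 𝕃)

/-- The periodic extension of a function on `Fin d`. -/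
def per (x : Fin d → 𝕃) (m : ℕ) : 𝕃 := x ⟨m % d, Nat.mod_lt _ (NeZero.pos d)⟩

theorem per_fin (a : Fin d) : per x a = x a := by
  rw [per]; congr 1; exact Fin.ext (Nat.mod_eq_of_lt a.2)

/-- The value of the relative trace on an element of `M_{d,n+1}`. -/
def trVal {n : ℕ} (i : Idx d n) : Y d n :=
  if i.2.1 = Fin.last n then algebraMap 𝕃 _ (if i.1 then y i.2.2 else x i.2.2)
  else pz • mElt d n i.1 (i.2.1 + 1) i.2.2 n

/-- The relative trace. -/
def relTr (n : ℕ) : Y d (n + 1) →ₗ[𝕃] Y d n :=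
  (∑ i, (LinearMap.mulRight 𝕃 (trVal x y i)).comp (LinearMap.proj i)).comp
    (LinearEquiv.ofBijective (comb d n) (comb_bijective d n)).symm.toLinearMap

theorem relTr_comb {n : ℕ} (f : Idx d n → Y d n) :
    relTr x y n (comb d n f) = ∑ i, f i * trVal x y i := by
  have : (LinearEquiv.ofBijective (comb d n) (comb_bijective d n)).symm (comb d n f) = f :=
    (LinearEquiv.ofBijective (comb d n) (comb_bijective d n)).symm_apply_apply f
  simp [relTr, this]

theorem relTr_mIdx {n : ℕ} (W : Y d n) (i : Idx d n) :
    relTr x y n (incl d n W * mIdx i) = W * trVal x y i := by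
  rw [← comb_single, relTr_comb, Finset.sum_eq_single i]
  · simp
  · intro j _ hj; simp [hj]
  · simp

theorem relTr_mul_left {n : ℕ} (W : Y d n) (X : Y d (n + 1)) :
    relTr x y n (incl d n W * X) = W * relTr x y n X := by
  obtain ⟨f, rfl⟩ := comb_surjective d n X
  rw [← comb_mul, relTr_comb, relTr_comb, Finset.mul_sum]
  simp only [mul_assoc]

theorem relTr_T {n : ℕ} (W : Y d n) (a : ℕ) :
    relTr x y n (incl d n W * t d (n + 1) (n + 1) ^ a) = per x a • W := by
  have h := relTr_mIdx x y W (false, Fin.last n, ⟨a % d, Nat.mod_lt _ (NeZero.pos d)⟩)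
  rw [mIdx_last] at h
  simp only [Bool.false_eq_true, if_false, t_pow_mod (d := d) (j := n + 1) ⟨by omega, le_rfl⟩,
    trVal, if_true] at h
  rw [h, ← Algebra.commutes, ← Algebra.smul_def, per]

theorem relTr_B {n : ℕ} (W : Y d n) (a : ℕ) :
    relTr x y n (incl d n W * (bAt d (n + 1) (n + 1) * t d (n + 1) (n + 1) ^ a)) = per y a • W := by
  have h := relTr_mIdx x y W (true, Fin.last n, ⟨a % d, Nat.mod_lt _ (NeZero.pos d)⟩)
  rw [mIdx_last] at h
  simp only [t_pow_mod (d := d) (j := n + 1) ⟨by omega, le_rfl⟩, trVal, if_true] at h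
  rw [h, ← Algebra.commutes, ← Algebra.smul_def, per]

/-- With `C` expanded over `Y_n`, its coefficients pass through `g`, and each `g m` is a non-last
element of the next `M`, where `tr` replaces `g` by `z`. -/
theorem relTr_G {n : ℕ} (A C : Y d (n + 1)) :
    relTr x y (n + 1) (incl d (n + 1) A * g d (n + 2) (n + 1) * incl d (n + 1) C)
      = pz • (A * C) := by
  obtain ⟨f, rfl⟩ := comb_surjective d n C
  rw [comb_apply, map_sum, Finset.mul_sum, map_sum, Finset.mul_sum, Finset.smul_sum]
  refine Finset.sum_congr rfl fun i _ => ?_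
  rw [map_mul (incl d (n + 1)), mul_assoc, ← mul_assoc (g _ _ _), G_incl_comm,
    mul_assoc (incl _ _ (incl _ _ _)), g_mul_mIdx, ← mul_assoc, ← map_mul, relTr_mIdx, trVal, if_neg (Fin.castSucc_lt_last _).ne,
    mul_smul_comm, mul_assoc]
  rfl

theorem relTr_J_right {n : ℕ} {X : Y d (n + 1)} (hX : X ∈ J d n) (W : Y d n) :
    relTr x y n (X * incl d n W) = relTr x y n X * W := by
  rw [← sub_eq_zero]
  refine span_le_comap (S := (⊥ : Submodule 𝕃 (Y d n)))
    ((relTr x y n).comp (LinearMap.mulRight 𝕃 (incl d n W))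
      - (LinearMap.mulRight 𝕃 W).comp (relTr x y n)) ?_ hX
  rintro _ ⟨hn, A, C, rfl⟩
  obtain ⟨n, rfl⟩ : ∃ k, n = k + 1 := ⟨n - 1, by omega⟩
  simp only [LinearMap.sub_apply, LinearMap.comp_apply, LinearMap.mulRight_apply,
    Submodule.mem_bot]
  rw [mul_assoc, ← map_mul, relTr_G, relTr_G, smul_mul_assoc, mul_assoc, sub_self]

theorem relTr_G_T {n : ℕ} (A C : Y d (n + 1)) (a : ℕ) :
    relTr x y (n + 1) (incl d (n + 1) A * g d (n + 2) (n + 1) * incl d (n + 1) C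
      * t d (n + 2) (n + 2) ^ a) = pz • (A * t d (n + 1) (n + 1) ^ a * C) := by
  rw [incl_G_incl_T, relTr_G]

/-- This is the obstruction to right linearity of `tr`. By the Leibniz rule, and right linearity on
`J`, which contains the commutators, it need only be checked on generators. -/
theorem relTr_commutator {n : ℕ} (h : Y d n) (a : ℕ) :
    relTr x y n ((bAt d (n + 1) (n + 1) * incl d n h - incl d n h * bAt d (n + 1) (n + 1))
      * t d (n + 1) (n + 1) ^ a) = 0 := by
  have of_comm {X : Y d (n + 1)} (hX : Commute X (bAt d (n + 1) (n + 1))) :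
      relTr x y n ((bAt d (n + 1) (n + 1) * X - X * bAt d (n + 1) (n + 1))
        * t d (n + 1) (n + 1) ^ a) = 0 := by
    rw [hX.eq, sub_self, zero_mul, map_zero]
  induction h using adjoin_induction with
  | hb h =>
    obtain ⟨n, rfl⟩ : ∃ k, n = k + 1 := ⟨n - 1, by omega⟩
    obtain ⟨P, P', hP, hPt, h⟩ := bAt_b_commutator d n
    have hPta : P * t d (n + 1) (n + 1) ^ a = t d (n + 1) 1 ^ a * P :=
      SemiconjBy.pow_right (a := P) hPt a
    have hbt (m : ℕ) : b d (n + 1) * t d (n + 1) 1 ^ m = t d (n + 1) 1 ^ m * b d (n + 1) :=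
      ((t_b ⟨le_rfl, by omega⟩).pow_left m).eq.symm
    rw [h, smul_mul_assoc, Finset.sum_mul, map_smul, map_sum, Finset.sum_eq_zero, smul_zero]
    intro m hm
    -- `P` turns the last framing into `t₁` and then cancels against `P'`. The exponents of `t₁` add
    -- up to `a + d`, so both kinds of summand reduce to `t₁^a b₁²` and their difference vanishes.
    have e1 : b d (n + 1) * t d (n + 1) 1 ^ m * P * t d (n + 1) (n + 1) ^ a
        * (P' * (t d (n + 1) 1 ^ (d - m) * b d (n + 1)))
        = t d (n + 1) 1 ^ a * (b d (n + 1) * b d (n + 1)) := by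
      rw [mul_assoc _ P, hPta]
      simp only [mul_assoc]
      rw [← mul_assoc P, hP, one_mul, ← mul_assoc _ _ (b d (n + 1)), ← mul_assoc _ _ (b d (n + 1)),
        ← pow_add, ← pow_add, ← mul_assoc, hbt, mul_assoc,
        show m + (a + (d - m)) = a + d by have := Finset.mem_range.mp hm; omega,
        pow_add, t_pow_d d (n + 1) 1 ⟨le_rfl, by omega⟩, mul_one]
    have e2 : t d (n + 1) 1 ^ (d - m) * P * t d (n + 1) (n + 1) ^ a
        * (P' * (t d (n + 1) 1 ^ m * (b d (n + 1) * b d (n + 1))))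
        = t d (n + 1) 1 ^ a * (b d (n + 1) * b d (n + 1)) := by
      rw [mul_assoc _ P, hPta]
      simp only [mul_assoc]
      rw [← mul_assoc P, hP, one_mul, ← mul_assoc _ _ (b d (n + 1) * _),
        ← mul_assoc _ _ (b d (n + 1) * _), ← pow_add, ← pow_add,
        show d - m + (a + m) = a + d by have := Finset.mem_range.mp hm; omega,
        pow_add, t_pow_d d (n + 1) 1 ⟨le_rfl, by omega⟩, mul_one]
    rw [sub_mul, map_sub, relTr_G_T, relTr_G_T, e1, e2, sub_self]
  | hg i h => rw [incl_g h]; exact of_comm (g_bAt_of_gt h.1 ⟨by omega, le_rfl⟩)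
  | ht j h => rw [incl_t h]; exact of_comm (t_bAt ⟨h.1, by omega⟩ ⟨by omega, le_rfl⟩)
  | hc c => rw [AlgHom.commutes]; exact of_comm (Algebra.commutes c _)
  | hadd p q hp hq =>
    refine Eq.trans ?_ ((congrArg₂ (· + ·) hp hq).trans (add_zero _))
    rw [← map_add (relTr x y n), map_add (incl d n)]
    congr 1
    noncomm_ring
  | hmul p q hp hq =>
    have h1 := relTr_J_right x y (J_T a (bAt_incl_sub_mem_J p)) q
    rw [hp, zero_mul, mul_assoc, ((t_last_comm q).pow_left a).eq] at h1
    have h2 := relTr_mul_left x y p ((bAt d (n + 1) (n + 1) * incl d n q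
      - incl d n q * bAt d (n + 1) (n + 1)) * t d (n + 1) (n + 1) ^ a)
    rw [hq, mul_zero] at h2
    refine Eq.trans ?_ ((congrArg₂ (· + ·) h1 h2).trans (add_zero _))
    simp only [← map_add, map_mul (incl d n)]
    congr 1
    noncomm_ring

theorem relTr_mul_right {n : ℕ} (X : Y d (n + 1)) (W : Y d n) :
    relTr x y n (X * incl d n W) = relTr x y n X * W := by
  induction X using succ_induction with
  | hT V a =>
    rw [mul_assoc, ((t_last_comm W).pow_left a).eq, ← mul_assoc, ← map_mul, relTr_T, relTr_T,
      smul_mul_assoc]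
  | hB V a =>
    have h : incl d n V * (bAt d (n + 1) (n + 1) * t d (n + 1) (n + 1) ^ a) * incl d n W
        = incl d n (V * W) * (bAt d (n + 1) (n + 1) * t d (n + 1) (n + 1) ^ a) + incl d n V
          * ((bAt d (n + 1) (n + 1) * incl d n W - incl d n W * bAt d (n + 1) (n + 1))
            * t d (n + 1) (n + 1) ^ a) := by
      rw [mul_assoc, mul_assoc _ _ (incl d n W), ((t_last_comm W).pow_left a).eq, map_mul]
      noncomm_ring
    rw [h, map_add, relTr_B, relTr_mul_left x y V, relTr_commutator, mul_zero, add_zero, relTr_B,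
      smul_mul_assoc]
  | hG hn A C => exact relTr_J_right x y (Submodule.subset_span ⟨hn, A, C, rfl⟩) W
  | hadd X X' h h' => rw [add_mul, map_add, map_add, h, h', add_mul]

theorem relTr_isRelTrace : IsRelTrace d x y (relTr x y) := by
  intro n w _ a
  refine ⟨?_, ?_, fun s k h1 h2 => ?_⟩
  · rw [relTr_T, per_fin]
  · rw [relTr_B, per_fin]
  · obtain ⟨n, rfl⟩ : ∃ l, n = l + 1 := ⟨n - 1, by omega⟩
    rw [mElt_succ _ _ h2, ← incl_mElt _ _ h1 h2 le_rfl, ← mul_assoc, relTr_G]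

variable {x y} in
theorem IsRelTrace.unique {tr tr' : (n : ℕ) → Y d (n + 1) →ₗ[𝕃] Y d n} (h : IsRelTrace d x y tr)
    (h' : IsRelTrace d x y tr') : tr' = tr := by
  funext n
  refine LinearMap.ext_on (span_C d (n + 1)) ?_
  rintro _ ⟨w, hw, m, ⟨s, j, a, h1, h2, h3, rfl⟩, rfl⟩
  obtain ⟨e1, e2, e3⟩ := h n w hw ⟨a, h3⟩
  obtain ⟨f1, f2, f3⟩ := h' n w hw ⟨a, h3⟩
  rcases Nat.lt_or_ge n j with hj | hj
  · obtain rfl : j = n + 1 := by omega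
    cases s
    · simpa [mElt_self] using f1.trans e1.symm
    · simpa [mElt_self] using f2.trans e2.symm
  · exact (f3 s j h1 hj).trans (e3 s j h1 hj).symm

end Trace

/-! ### The trace property -/

theorem sum_pow_symm {R : Type*} [Semiring R] {d : ℕ} {p q : R} (hp : p ^ d = 1) (hq : q ^ d = 1) :
    ∑ m ∈ Finset.range d, p ^ m * q ^ (d - m) = ∑ m ∈ Finset.range d, p ^ (d - m) * q ^ m := by
  rcases d with _ | k
  · simp
  · rw [Finset.sum_range_succ', Finset.sum_range_succ', ← Finset.sum_range_reflect]
    simp only [Nat.sub_zero, pow_zero, hp, hq]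
    congr 1
    refine Finset.sum_congr rfl fun m hm => ?_
    have hm' := Finset.mem_range.mp hm
    congr 2 <;> omega

/-- Both sides are convolutions over `ℤ/d`, exchanged by the substitution `k ↦ a - c - k`. The
exponent `d - m` equals `d` at `m = 0`, hence the periodic extension. -/
theorem sum_per_symm {d : ℕ} [NeZero d] (x y : Fin d → 𝕃) (a c : ℕ) :
    ∑ m ∈ Finset.range d, per x (d - m + a) * per y (m + c)
      = ∑ m ∈ Finset.range d, per y (d - m + a) * per x (m + c) := by
  have hper (x : Fin d → 𝕃) (m : ℕ) : per x m = per x (m : ZMod d).val := by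
    simp [per, ZMod.val_natCast]
  have hsum (F : ZMod d → 𝕃) : ∑ m ∈ Finset.range d, F m = ∑ k : ZMod d, F k := by
    obtain _ | d := d
    · exact absurd rfl (NeZero.ne 0)
    · rw [Finset.sum_range]
      exact Finset.sum_congr rfl fun i _ => congrArg F (Fin.cast_val_eq_self i)
  have hcast (x y : Fin d → 𝕃) : ∑ m ∈ Finset.range d, per x (d - m + a) * per y (m + c)
      = ∑ k : ZMod d, per x ((a : ZMod d) - k).val * per y (k + c).val := by
    rw [← hsum fun k => per x ((a : ZMod d) - k).val * per y (k + c).val]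
    refine Finset.sum_congr rfl fun m hm => ?_
    rw [hper x, hper y]
    congr 3
    · push_cast [Nat.cast_sub (Finset.mem_range.mp hm).le, CharP.cast_eq_zero]
      ring_nf
    · push_cast; rfl
  rw [hcast, hcast, ← Equiv.sum_comp (Equiv.subLeft ((a : ZMod d) - c))]
  refine Finset.sum_congr rfl fun k _ => ?_
  rw [mul_comm]
  congr 3 <;> simp only [Equiv.subLeft_apply] <;> ring

section Last
variable {d n : ℕ}

local notation "ι" => incl d (n + 1)
local notation "G" => g d (n + 2) (n + 1)
local notation "G'" => gInv d (n + 2) (n + 1)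
local notation "T₀" => t d (n + 1) (n + 1)
local notation "T₁" => t d (n + 2) (n + 2)
local notation "B₀" => bAt d (n + 1) (n + 1)
local notation "B₁" => bAt d (n + 2) (n + 2)

/-- Both inverses in `g⁻¹ B₁ = B₀ g⁻¹` are expanded. -/
theorem G_B₁ : G * B₁ = ι B₀ * G - ud d • ∑ m ∈ Finset.range d, ι (B₀ * T₀ ^ m) * T₁ ^ (d - m)
    + ud d • ∑ m ∈ Finset.range d, ι (T₀ ^ m) * (B₁ * T₁ ^ (d - m)) := by
  have h1 : G' * B₁ = ι B₀ * G' := by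
    rw [bAt_last, ← mul_assoc, ← mul_assoc, inv_mul_G, one_mul]
  rw [inv_eq, sub_mul, mul_sub, sub_eq_iff_eq_add] at h1
  rw [h1]
  simp only [smul_mul_assoc, mul_smul_comm, Finset.sum_mul, Finset.mul_sum, map_mul, mul_assoc,
    T_B_comm]

theorem G_B₀_B₁ : G * ι B₀ * B₁ = ι B₀ * G * ι B₀ := by
  have hbr : ι B₀ * G * ι B₀ * G = G * ι B₀ * G * ι B₀ := by
    rw [incl_bAt_last]; exact bAt_braid (by omega) le_rfl
  rw [bAt_last, ← mul_assoc, ← mul_assoc, ← hbr, mul_assoc _ G G', G_mul_inv, mul_one]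

theorem T_mul_G (a : ℕ) : T₁ ^ a * G = G * ι (T₀ ^ a) := (G_mul_incl_T a).symm

theorem B₁_T_G (a : ℕ) : B₁ * T₁ ^ a * G = G * ι (B₀ * T₀ ^ a) := by
  rw [mul_assoc, T_mul_G, ← mul_assoc, ← G_mul_incl_B, mul_assoc, map_mul]

end Last

section Trace
variable {d : ℕ} [NeZero d] (x y : Fin d → 𝕃)

theorem relTr_mul_T_comm {n : ℕ} (X : Y d (n + 1)) :
    relTr x y n (X * t d (n + 1) (n + 1)) = relTr x y n (t d (n + 1) (n + 1) * X) := by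
  induction X using succ_induction with
  | hT W a => rw [mul_assoc, ← mul_assoc (t d _ _), (t_last_comm W).eq, mul_assoc, pow_mul_comm']
  | hB W a =>
    rw [mul_assoc, mul_assoc, ← pow_succ, ← mul_assoc (t d _ _), (t_last_comm W).eq, mul_assoc,
      ← mul_assoc (t d _ _), (t_bAt ⟨by omega, le_rfl⟩ ⟨by omega, le_rfl⟩).eq, mul_assoc,
      ← pow_succ']
  | hG hn A C =>
    obtain ⟨n, rfl⟩ : ∃ l, n = l + 1 := ⟨n - 1, by omega⟩
    have h1 := relTr_G_T x y A C 1
    have h2 := T_mul_G (d := d) (n := n) 1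
    rw [pow_one, pow_one] at h1 h2
    rw [h1, ← mul_assoc, ← mul_assoc, (t_last_comm A).eq, mul_assoc (incl _ _ A), h2, ← mul_assoc,
      mul_assoc _ _ (incl _ _ C), ← map_mul, relTr_G, mul_assoc]
  | hadd X X' h h' => rw [add_mul, mul_add, map_add, map_add, h, h']

/-- The value of the relative trace on `gₙ₊₁ bₙ₊₂ tₙ₊₂^a`. -/
def gbVal (n a : ℕ) : Y d (n + 1) :=
  pz • (bAt d (n + 1) (n + 1) * t d (n + 1) (n + 1) ^ a)
  - ud d • ∑ m ∈ Finset.range d,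
      per x (d - m + a) • (bAt d (n + 1) (n + 1) * t d (n + 1) (n + 1) ^ m)
  + ud d • ∑ m ∈ Finset.range d, per y (d - m + a) • t d (n + 1) (n + 1) ^ m

theorem relTr_GB (n a : ℕ) : relTr x y (n + 1) (g d (n + 2) (n + 1) * bAt d (n + 2) (n + 2)
    * t d (n + 2) (n + 2) ^ a) = gbVal x y n a := by
  have h := relTr_G_T x y (bAt d (n + 1) (n + 1)) 1 a
  rw [map_one, mul_one, mul_one] at h
  rw [G_B₁, add_mul, sub_mul, map_add, map_sub, h, gbVal]
  simp only [smul_mul_assoc, map_smul, Finset.sum_mul, map_sum]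
  congr 1
  · congr 2
    refine Finset.sum_congr rfl fun m _ => ?_
    rw [mul_assoc, ← pow_add, relTr_T]
  · congr 1
    refine Finset.sum_congr rfl fun m _ => ?_
    rw [mul_assoc, mul_assoc, ← pow_add, relTr_B]

/-- The two correction sums in `gbVal` become convolutions of `x` and `y` in opposite orders, which
cancel. -/
theorem relTr_gbVal_T (n a c : ℕ) :
    relTr x y n (gbVal x y n a * t d (n + 1) (n + 1) ^ c) = (pz * per y (a + c)) • 1 := by
  have hB (m : ℕ) : relTr x y n (bAt d (n + 1) (n + 1) * t d (n + 1) (n + 1) ^ m) = per y m • 1 := by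
    simpa using relTr_B x y (n := n) 1 m
  have hT (m : ℕ) : relTr x y n (t d (n + 1) (n + 1) ^ m) = per x m • 1 := by
    simpa using relTr_T x y (n := n) 1 m
  simp only [gbVal, add_mul, sub_mul, smul_mul_assoc, Finset.sum_mul, map_add, map_sub, map_smul,
    map_sum, mul_assoc, ← pow_add, hB, hT, smul_smul, ← Finset.sum_smul]
  rw [sum_per_symm, sub_add_cancel]

/-- Compatibility of `gbVal` along the tower: against `g_{n+1}` each `T` or `B` term drops one level
with a factor `z`. -/
theorem relTr_gbVal_G (n a : ℕ) :
    relTr x y (n + 1) (gbVal x y (n + 1) a * g d (n + 2) (n + 1)) = pz • gbVal x y n a := by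
  have hG (C : Y d (n + 1)) : relTr x y (n + 1) (g d (n + 2) (n + 1) * incl d (n + 1) C)
      = pz • C := by
    simpa using relTr_G x y 1 C
  simp only [gbVal, add_mul, sub_mul, smul_mul_assoc, Finset.sum_mul, map_add, map_sub, map_smul,
    map_sum, B₁_T_G, T_mul_G, hG, smul_add, smul_sub, Finset.smul_sum, smul_smul,
    mul_comm]

/-- The conjugation average `A ↦ tr (gₙ₊₁ A gₙ₊₁)`. -/
def gAvg (n : ℕ) : Y d (n + 1) →ₗ[𝕃] Y d (n + 1) :=
  (relTr x y (n + 1)).comp ((LinearMap.mulLeftRight 𝕃 (g d (n + 2) (n + 1), g d (n + 2) (n + 1))).comp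
    (incl d (n + 1)).toLinearMap)

theorem gAvg_apply {n : ℕ} (A : Y d (n + 1)) : gAvg x y n A
    = relTr x y (n + 1) (g d (n + 2) (n + 1) * incl d (n + 1) A * g d (n + 2) (n + 1)) := by
  simp [gAvg]

/-- The deviation of `gAvg` from its symmetric part. -/
def defect (n : ℕ) : Y d (n + 1) →ₗ[𝕃] Y d (n + 1) :=
  gAvg x y n - ((pu - pu⁻¹) * pz) • LinearMap.id - (incl d n).toLinearMap.comp (relTr x y n)

theorem defect_apply {n : ℕ} (A : Y d (n + 1)) : defect x y n A
    = gAvg x y n A - ((pu - pu⁻¹) * pz) • A - incl d n (relTr x y n A) := rfl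

theorem defect_mul_left {n : ℕ} (W : Y d n) (A : Y d (n + 1)) :
    defect x y n (incl d n W * A) = incl d n W * defect x y n A := by
  have : gAvg x y n (incl d n W * A) = incl d n W * gAvg x y n A := by
    rw [gAvg_apply, gAvg_apply, map_mul (incl d (n + 1)), ← mul_assoc, G_incl_comm, mul_assoc, mul_assoc,
      relTr_mul_left, ← mul_assoc]
  rw [defect_apply, defect_apply, this, relTr_mul_left, map_mul, mul_sub, mul_sub, mul_smul_comm]

theorem defect_mul_right {n : ℕ} (W : Y d n) (A : Y d (n + 1)) :
    defect x y n (A * incl d n W) = defect x y n A * incl d n W := by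
  have : gAvg x y n (A * incl d n W) = gAvg x y n A * incl d n W := by
    rw [gAvg_apply, gAvg_apply, map_mul (incl d (n + 1)), ← mul_assoc, mul_assoc _ (incl _ _ _) (g _ _ _),
      ← G_incl_comm, ← mul_assoc, relTr_mul_right]
  rw [defect_apply, defect_apply, this, relTr_mul_right, map_mul,
    sub_mul _ _ (incl d n W), sub_mul _ _ (incl d n W), smul_mul_assoc]

/-- When `Z` commutes with the framing, the `d` correction terms of `G_incl_G` all have trace `z Z`,
and their number cancels the `1/d` in `ud`. This is the source of the multiple of the identity
subtracted in `defect`. -/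
theorem gAvg_of_commute {n : ℕ} {Z : Y d (n + 1)} (hZ : Commute (t d (n + 1) (n + 1)) Z) :
    gAvg x y n Z = relTr x y (n + 1) (g d (n + 2) (n + 1) * incl d (n + 1) Z * gInv d (n + 2) (n + 1))
      + ((pu - pu⁻¹) * pz) • Z := by
  have hd : (d : 𝕃) ≠ 0 := NeZero.ne _
  rw [gAvg_apply, G_incl_G, map_add, map_smul, map_sum]
  congr 1
  rw [Finset.sum_congr rfl (g := fun _ => pz • Z), Finset.sum_const, Finset.card_range,
    ← Nat.cast_smul_eq_nsmul 𝕃, smul_smul, smul_smul, ud]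
  · congr 1; field_simp
  · intro m hm
    rw [relTr_G, ← mul_assoc, (hZ.pow_left _).eq, mul_assoc, ← pow_add,
      Nat.sub_add_cancel (Finset.mem_range.mp hm).le, t_pow_d d (n + 1) (n + 1) ⟨by omega, le_rfl⟩,
      mul_one]

theorem defect_T {n : ℕ} (W : Y d n) (a : ℕ) :
    defect x y n (incl d n W * t d (n + 1) (n + 1) ^ a) = 0 := by
  have h1 := relTr_T x y (n := n) 1 a
  have h2 := relTr_T x y (n := n + 1) 1 a
  rw [map_one, one_mul] at h1 h2
  rw [defect_mul_left, defect_apply, gAvg_of_commute x y ((Commute.refl _).pow_right a), G_T_inv,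
    h1, h2, map_smul, map_one, add_sub_cancel_right, sub_self, mul_zero]

theorem defect_B {n : ℕ} (W : Y d n) (a : ℕ) :
    defect x y n (incl d n W * (bAt d (n + 1) (n + 1) * t d (n + 1) (n + 1) ^ a)) = 0 := by
  have h1 := relTr_B x y (n := n) 1 a
  have h2 := relTr_B x y (n := n + 1) 1 a
  rw [map_one, one_mul] at h1 h2
  have hc : Commute (t d (n + 1) (n + 1)) (bAt d (n + 1) (n + 1) * t d (n + 1) (n + 1) ^ a) :=
    (t_bAt ⟨by omega, le_rfl⟩ ⟨by omega, le_rfl⟩).mul_right ((Commute.refl _).pow_right a)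
  rw [defect_mul_left, defect_apply, gAvg_of_commute x y hc, G_BT_inv,
    h1, h2, map_smul, map_one, add_sub_cancel_right, sub_self, mul_zero]

/-- By the braid relation `E(g_{n+1}) = tr(g_{n+1} g_{n+2} g_{n+1}) = z g_{n+1}²`; the quadratic
relation does the rest. As `defect` is a bimodule map vanishing on the other two kinds of elements,
this value determines it. -/
theorem defect_g {n : ℕ} : defect x y (n + 1) (g d (n + 2) (n + 1)) = ((pu - pu⁻¹) * pz) •
    (e d (n + 2) (n + 1) * g d (n + 2) (n + 1) - g d (n + 2) (n + 1)) := by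
  have h1 := G_conj_g (d := d) (n := n) 1 1
  have h2 := relTr_G x y (n := n) 1 1
  simp only [map_one, one_mul, mul_one] at h1 h2
  rw [defect_apply, gAvg_apply, h1, relTr_G, h2, g_sq d (n + 2) (n + 1) ⟨by omega, le_rfl⟩,
    map_smul, map_one]
  simp only [smul_add, smul_sub, smul_smul, mul_comm pz]
  abel

end Trace

theorem e_last (d n : ℕ) : e d (n + 2) (n + 1) = (d : 𝕃)⁻¹ • ∑ m ∈ Finset.range d,
    incl d (n + 1) (t d (n + 1) (n + 1) ^ m) * t d (n + 2) (n + 2) ^ (d - m) := by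
  simp only [e, map_pow, incl_t_last]

theorem e_last_symm (d n : ℕ) : e d (n + 2) (n + 1) = (d : 𝕃)⁻¹ • ∑ m ∈ Finset.range d,
    incl d (n + 1) (t d (n + 1) (n + 1) ^ (d - m)) * t d (n + 2) (n + 2) ^ m := by
  rw [e, sum_pow_symm (t_pow_d d _ _ ⟨by omega, by omega⟩) (t_pow_d d _ _ ⟨by omega, le_rfl⟩)]
  simp only [map_pow, incl_t_last]

/-- The symmetry of `defect` in the case where both arguments lie in `J`. -/
theorem trace_g_eg {d n : ℕ} (Tr : Y d (n + 2) →ₗ[𝕃] 𝕃) (hTr : ∀ X X', Tr (X * X') = Tr (X' * X))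
    (V V' : Y d (n + 1)) :
    Tr (incl d (n + 1) V * g d (n + 2) (n + 1) * incl d (n + 1) V'
        * (e d (n + 2) (n + 1) * g d (n + 2) (n + 1)))
      = Tr (g d (n + 2) (n + 1) * (incl d (n + 1) V * (e d (n + 2) (n + 1) * g d (n + 2) (n + 1))
        * incl d (n + 1) V')) := by
  nth_rewrite 1 [e_last_symm]
  rw [e_last]
  simp only [smul_mul_assoc, mul_smul_comm, Finset.mul_sum, Finset.sum_mul, map_smul, map_sum]
  congr 1
  refine Finset.sum_congr rfl fun m _ => ?_
  -- Framings are pushed across the `g`'s until the summands on both sides are cyclic rearrangements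
  -- of one product. The left side uses the reflected form of `e`, so that the exponents agree.
  have h : g d (n + 2) (n + 1) * (incl d (n + 1) V * (incl d (n + 1) (t d (n + 1) (n + 1) ^ m)
        * t d (n + 2) (n + 2) ^ (d - m) * g d (n + 2) (n + 1)) * incl d (n + 1) V')
      = (incl d (n + 1) (t d (n + 1) (n + 1) ^ (d - m)) * g d (n + 2) (n + 1) * incl d (n + 1) V)
        * (g d (n + 2) (n + 1) * incl d (n + 1) V' * t d (n + 2) (n + 2) ^ m) := by
    rw [← T_pow_comm, mul_assoc (t d _ _ ^ _), ← G_mul_T, ← mul_assoc (incl _ _ V), ← T_pow_comm,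
      ← G_mul_T, mul_assoc (g d (n + 2) (n + 1)) (incl _ _ V'), ← T_pow_comm]
    simp only [mul_assoc]
  rw [h, hTr (_ * incl d (n + 1) V), ← mul_assoc _ _ (incl d (n + 1) V), hTr _ (incl d (n + 1) V),
    ← T_pow_comm m (t d (n + 1) (n + 1) ^ (d - m))]
  simp only [mul_assoc]

section Trace
variable {d : ℕ} [NeZero d] (x y : Fin d → 𝕃)

/-- Each of the `d` summands of `e` has its framings merged to total exponent `a + d` when `tr` is
taken, so inserting `e` next to `g` does not change the trace. -/
theorem relTr_T_eg_sub_g (n a : ℕ) : relTr x y (n + 1) (t d (n + 2) (n + 2) ^ a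
    * (e d (n + 2) (n + 1) * g d (n + 2) (n + 1) - g d (n + 2) (n + 1))) = 0 := by
  have hd : (d : 𝕃) ≠ 0 := NeZero.ne _
  have hG := relTr_G x y (n := n) 1 (t d (n + 1) (n + 1) ^ a)
  rw [map_one, one_mul, one_mul] at hG
  rw [mul_sub, map_sub, T_mul_G, hG, sub_eq_zero, e_last, smul_mul_assoc, mul_smul_comm, map_smul,
    Finset.sum_mul, Finset.mul_sum, map_sum, Finset.sum_congr rfl
      (g := fun _ => pz • t d (n + 1) (n + 1) ^ a), Finset.sum_const, Finset.card_range,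
    ← Nat.cast_smul_eq_nsmul 𝕃, inv_smul_smul₀ hd]
  intro m hm
  rw [mul_assoc, ← mul_assoc, T_pow_comm, mul_assoc, ← mul_assoc (_ ^ a), ← pow_add, T_mul_G,
    ← mul_assoc, relTr_G, ← pow_add,
    show m + (a + (d - m)) = a + d by have := Finset.mem_range.mp hm; omega, pow_add,
    t_pow_d d (n + 1) (n + 1) ⟨by omega, le_rfl⟩, mul_one]

theorem relTr_BT_eg_sub_g (n a : ℕ) : relTr x y (n + 1)
    (bAt d (n + 2) (n + 2) * t d (n + 2) (n + 2) ^ a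
      * (e d (n + 2) (n + 1) * g d (n + 2) (n + 1) - g d (n + 2) (n + 1))) = 0 := by
  have hBe : bAt d (n + 2) (n + 2) * e d (n + 2) (n + 1)
      = e d (n + 2) (n + 1) * bAt d (n + 2) (n + 2) := by
    rw [e_last, mul_smul_comm, smul_mul_assoc, Finset.mul_sum, Finset.sum_mul]
    congr 1
    refine Finset.sum_congr rfl fun m _ => ?_
    rw [← mul_assoc, ← T₀_B₁_comm, mul_assoc, mul_assoc, T_B_comm]
  have h : bAt d (n + 2) (n + 2) * t d (n + 2) (n + 2) ^ a
      * (e d (n + 2) (n + 1) * g d (n + 2) (n + 1) - g d (n + 2) (n + 1))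
      = t d (n + 2) (n + 2) ^ a * (e d (n + 2) (n + 1) * g d (n + 2) (n + 1)
        - g d (n + 2) (n + 1)) * incl d (n + 1) (bAt d (n + 1) (n + 1)) := by
    rw [← T_B_comm, mul_assoc, mul_assoc, mul_sub, sub_mul, mul_assoc (e _ _ _), G_mul_incl_B,
      ← mul_assoc (bAt _ _ _), hBe, mul_assoc (e _ _ _)]
  rw [h, relTr_mul_right, relTr_T_eg_sub_g, zero_mul]

theorem bigTr_succ {n : ℕ} (X : Y d (n + 1)) :
    bigTr d (relTr x y) (n + 1) X = bigTr d (relTr x y) n (relTr x y n X) := rfl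

theorem bigTr_defect_g {n : ℕ}
    (ih : ∀ X X', bigTr d (relTr x y) (n + 2) (X * X') = bigTr d (relTr x y) (n + 2) (X' * X))
    (A : Y d (n + 2)) :
    bigTr d (relTr x y) (n + 2) (A * defect x y (n + 1) (g d (n + 2) (n + 1)))
      = bigTr d (relTr x y) (n + 2) (g d (n + 2) (n + 1) * defect x y (n + 1) A) := by
  induction A using succ_induction with
  | hT V a =>
    rw [defect_T, mul_zero, map_zero, defect_g, mul_smul_comm, map_smul, bigTr_succ, mul_assoc,
      relTr_mul_left, relTr_T_eg_sub_g, mul_zero, map_zero, smul_zero]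
  | hB V a =>
    rw [defect_B, mul_zero, map_zero, defect_g, mul_smul_comm, map_smul, bigTr_succ, mul_assoc,
      relTr_mul_left, relTr_BT_eg_sub_g, mul_zero, map_zero, smul_zero]
  | hG _ V V' =>
    rw [defect_mul_right, defect_mul_left, defect_g, mul_smul_comm, mul_smul_comm, smul_mul_assoc,
      mul_smul_comm, map_smul, map_smul]
    generalize (pu - pu⁻¹) * pz = c
    rw [mul_sub, mul_sub, sub_mul, mul_sub, map_sub, map_sub, trace_g_eg _ ih,
      ih _ (g d (n + 2) (n + 1))]
  | hadd A A' h h' => rw [add_mul, map_add, map_add, mul_add, map_add, h, h']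

/-- Cyclicity and bilinearity of `defect` move `W` and `W'` into the other argument, which leaves
the case of `g` alone. -/
theorem bigTr_defect_J {n : ℕ}
    (ih : ∀ X X', bigTr d (relTr x y) (n + 1) (X * X') = bigTr d (relTr x y) (n + 1) (X' * X))
    (hn : 1 ≤ n) (A : Y d (n + 1)) (W W' : Y d n) :
    bigTr d (relTr x y) (n + 1)
        (A * defect x y n (incl d n W * g d (n + 1) n * incl d n W'))
      = bigTr d (relTr x y) (n + 1)
        (incl d n W * g d (n + 1) n * incl d n W' * defect x y n A) := by
  obtain ⟨n, rfl⟩ : ∃ l, n = l + 1 := ⟨n - 1, by omega⟩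
  have h := bigTr_defect_g x y ih (incl d (n + 1) W' * A * incl d (n + 1) W)
  rw [defect_mul_right, defect_mul_left] at h ⊢
  rw [← mul_assoc A, ih _ (incl d (n + 1) W'), mul_assoc (incl d (n + 1) W), mul_assoc (incl _ _ W),
    ih (incl d (n + 1) W) (_ * _)]
  simp only [mul_assoc] at h ⊢
  exact h

theorem bigTr_defect {n : ℕ}
    (ih : ∀ X X', bigTr d (relTr x y) (n + 1) (X * X') = bigTr d (relTr x y) (n + 1) (X' * X))
    (A A' : Y d (n + 1)) :
    bigTr d (relTr x y) (n + 1) (A * defect x y n A')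
      = bigTr d (relTr x y) (n + 1) (A' * defect x y n A) := by
  induction A' using succ_induction with
  | hG hn W W' => exact bigTr_defect_J x y ih hn A W W'
  | hadd X X' h h' => rw [map_add, mul_add, map_add, add_mul, map_add, h, h']
  | hT V a =>
    rw [defect_T, mul_zero, map_zero]
    induction A using succ_induction with
    | hT V a => rw [defect_T, mul_zero, map_zero]
    | hB V a => rw [defect_B, mul_zero, map_zero]
    | hG hn W W' => rw [bigTr_defect_J x y ih hn, defect_T, mul_zero, map_zero]
    | hadd X X' h h' => rw [map_add, mul_add, map_add, ← h, ← h', add_zero]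
  | hB V a =>
    rw [defect_B, mul_zero, map_zero]
    induction A using succ_induction with
    | hT V a => rw [defect_T, mul_zero, map_zero]
    | hB V a => rw [defect_B, mul_zero, map_zero]
    | hG hn W W' => rw [bigTr_defect_J x y ih hn, defect_B, mul_zero, map_zero]
    | hadd X X' h h' => rw [map_add, mul_add, map_add, ← h, ← h', add_zero]

/-- The two sides are `Tr(A E(C))` and `Tr(E(A) C)`, so self-adjointness of `E` is what is needed.
Its three parts, `defect`, a scalar and `tr` followed by inclusion, are each symmetric; the last one
uses the trace property two levels down. -/
theorem bigTr_G_J {n : ℕ}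
    (ih₀ : ∀ X X', bigTr d (relTr x y) n (X * X') = bigTr d (relTr x y) n (X' * X))
    (ih : ∀ X X', bigTr d (relTr x y) (n + 1) (X * X') = bigTr d (relTr x y) (n + 1) (X' * X))
    (A C : Y d (n + 1)) :
    bigTr d (relTr x y) (n + 2) (incl d (n + 1) A * g d (n + 2) (n + 1) * incl d (n + 1) C
        * g d (n + 2) (n + 1))
      = bigTr d (relTr x y) (n + 2) (g d (n + 2) (n + 1)
        * (incl d (n + 1) A * g d (n + 2) (n + 1) * incl d (n + 1) C)) := by
  have avg (A : Y d (n + 1)) : gAvg x y n A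
      = defect x y n A + ((pu - pu⁻¹) * pz) • A + incl d n (relTr x y n A) := by
    rw [defect_apply]; abel
  have h1 : relTr x y (n + 1) (incl d (n + 1) A * g d (n + 2) (n + 1) * incl d (n + 1) C
        * g d (n + 2) (n + 1)) = A * gAvg x y n C := by
    rw [gAvg_apply, ← relTr_mul_left]; simp only [mul_assoc]
  have h2 : relTr x y (n + 1) (g d (n + 2) (n + 1)
        * (incl d (n + 1) A * g d (n + 2) (n + 1) * incl d (n + 1) C)) = gAvg x y n A * C := by
    rw [gAvg_apply, ← relTr_mul_right]; simp only [mul_assoc]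
  have h3 (A C : Y d (n + 1)) : bigTr d (relTr x y) (n + 1) (A * incl d n (relTr x y n C))
      = bigTr d (relTr x y) n (relTr x y n A * relTr x y n C) := by
    rw [bigTr_succ, relTr_mul_right]
  rw [bigTr_succ x y (n := n + 1), h1, bigTr_succ x y (n := n + 1), h2, ih (gAvg x y n A), avg, avg]
  simp only [mul_add, map_add, mul_smul_comm, map_smul, h3]
  rw [bigTr_defect x y ih A C, ih A C, ih₀ (relTr x y n A)]

/-- The remaining hard elements are `A B₁ T₁^a`, with `A` decomposed one level down: `T₀` powers
lead to `relTr_gbVal_T`, factors `B₀` to `G_B₀_B₁`, and factors `g` to `relTr_gbVal_G`. -/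
theorem bigTr_G {n : ℕ}
    (ih₀ : ∀ X X', bigTr d (relTr x y) n (X * X') = bigTr d (relTr x y) n (X' * X))
    (ih : ∀ X X', bigTr d (relTr x y) (n + 1) (X * X') = bigTr d (relTr x y) (n + 1) (X' * X))
    (X : Y d (n + 2)) :
    bigTr d (relTr x y) (n + 2) (X * g d (n + 2) (n + 1))
      = bigTr d (relTr x y) (n + 2) (g d (n + 2) (n + 1) * X) := by
  have ofJ {X : Y d (n + 2)} (hX : X ∈ J d (n + 1)) :
      bigTr d (relTr x y) (n + 2) (X * g d (n + 2) (n + 1))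
        = bigTr d (relTr x y) (n + 2) (g d (n + 2) (n + 1) * X) := by
    rw [← sub_eq_zero]
    refine span_le_comap (S := (⊥ : Submodule 𝕃 𝕃)) ((bigTr d (relTr x y) (n + 2)).comp
      (LinearMap.mulRight 𝕃 (g d (n + 2) (n + 1)) - LinearMap.mulLeft 𝕃 (g d (n + 2) (n + 1))))
      ?_ hX |> fun h => by simpa using h
    rintro _ ⟨-, A, C, rfl⟩
    simpa [sub_eq_zero] using bigTr_G_J x y ih₀ ih A C
  induction X using succ_induction with
  | hG _ A C => exact bigTr_G_J x y ih₀ ih A C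
  | hT A a =>
    have h1 : incl d (n + 1) A * t d (n + 2) (n + 2) ^ a * g d (n + 2) (n + 1)
        = incl d (n + 1) A * g d (n + 2) (n + 1) * incl d (n + 1) (t d (n + 1) (n + 1) ^ a) := by
      rw [mul_assoc, T_mul_G, mul_assoc]
    have h2 : g d (n + 2) (n + 1) * (incl d (n + 1) A * t d (n + 2) (n + 2) ^ a)
        = incl d (n + 1) (t d (n + 1) (n + 1) ^ a) * g d (n + 2) (n + 1) * incl d (n + 1) A := by
      rw [← T_pow_comm, ← mul_assoc, G_mul_T]
    rw [h1, h2, bigTr_succ x y (n := n + 1), bigTr_succ x y (n := n + 1), relTr_G, relTr_G, map_smul, map_smul, ih]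
  | hB A a =>
    have h1 (A : Y d (n + 1)) : relTr x y (n + 1) (incl d (n + 1) A * (bAt d (n + 2) (n + 2)
        * t d (n + 2) (n + 2) ^ a) * g d (n + 2) (n + 1))
        = pz • (A * (bAt d (n + 1) (n + 1) * t d (n + 1) (n + 1) ^ a)) := by
      rw [mul_assoc, B₁_T_G, ← mul_assoc, relTr_G]
    induction A using succ_induction with
    | hT V c =>
      have h2 : g d (n + 2) (n + 1) * (incl d (n + 1) (incl d n V * t d (n + 1) (n + 1) ^ c)
          * (bAt d (n + 2) (n + 2) * t d (n + 2) (n + 2) ^ a))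
          = incl d (n + 1) (incl d n V) * (g d (n + 2) (n + 1) * bAt d (n + 2) (n + 2)
            * t d (n + 2) (n + 2) ^ a * incl d (n + 1) (t d (n + 1) (n + 1) ^ c)) := by
        rw [map_mul, mul_assoc, ← mul_assoc, G_incl_comm, ← mul_assoc (incl _ _ (_ ^ c)),
          T₀_B₁_comm, mul_assoc (bAt _ _ _), ← T_pow_comm]
        simp only [mul_assoc]
      rw [bigTr_succ x y (n := n + 1), h1, bigTr_succ x y (n := n + 1), h2, relTr_mul_left, relTr_mul_right, relTr_GB,
        bigTr_succ, bigTr_succ x y (n := n), relTr_mul_left, relTr_gbVal_T, map_smul, mul_assoc,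
        relTr_mul_left, ← mul_assoc, B_T_comm, mul_assoc, ← pow_add]
      have h3 := relTr_B x y (n := n) 1 (c + a)
      rw [map_one, one_mul] at h3
      rw [h3, mul_smul_comm, mul_smul_comm, smul_smul, add_comm c]
    | hB V c =>
      have h2 : g d (n + 2) (n + 1) * (incl d (n + 1) (incl d n V * (bAt d (n + 1) (n + 1)
          * t d (n + 1) (n + 1) ^ c)) * (bAt d (n + 2) (n + 2) * t d (n + 2) (n + 2) ^ a))
          = incl d (n + 1) (incl d n V * bAt d (n + 1) (n + 1)) * g d (n + 2) (n + 1)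
            * incl d (n + 1) (bAt d (n + 1) (n + 1) * t d (n + 1) (n + 1) ^ c)
            * t d (n + 2) (n + 2) ^ a := by
        have hBB := G_B₀_B₁ (d := d) (n := n)
        rw [map_mul, map_mul, map_mul]
        simp only [mul_assoc] at hBB ⊢
        rw [← mul_assoc (g _ _ _) (incl _ _ (incl _ _ V)), G_incl_comm,
          ← mul_assoc (incl _ _ (_ ^ c)), T₀_B₁_comm]
        simp only [mul_assoc]
        rw [← mul_assoc (incl _ _ (bAt _ _ _)) (bAt _ _ _), ← mul_assoc (g _ _ _), hBB]
        simp only [mul_assoc]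
      have h3 : incl d n V * bAt d (n + 1) (n + 1) * t d (n + 1) (n + 1) ^ a
          * (bAt d (n + 1) (n + 1) * t d (n + 1) (n + 1) ^ c)
          = incl d n V * (bAt d (n + 1) (n + 1) * t d (n + 1) (n + 1) ^ c)
            * (bAt d (n + 1) (n + 1) * t d (n + 1) (n + 1) ^ a) := by
        simp only [mul_assoc]
        rw [← mul_assoc (_ ^ a), B_T_comm, ← mul_assoc (_ ^ c), B_T_comm, mul_assoc, mul_assoc,
          ← pow_add, ← pow_add, add_comm a c]
      rw [bigTr_succ x y (n := n + 1), h1, bigTr_succ x y (n := n + 1), h2, relTr_G_T, h3]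
    | hG hn V V' =>
      obtain ⟨n, rfl⟩ : ∃ l, n = l + 1 := ⟨n - 1, by omega⟩
      -- Moving `V'` to the right of `B` costs an element of `J`, for which the claim is already
      -- settled by `ofJ`. After that `V` and `V'` leave `tr` by bilinearity, and only `g_{n+1} B
      -- T^a` is left.
      have hJ : incl d (n + 2) (incl d (n + 1) V * g d (n + 2) (n + 1))
          * ((bAt d (n + 3) (n + 3) * incl d (n + 2) (incl d (n + 1) V')
            - incl d (n + 2) (incl d (n + 1) V') * bAt d (n + 3) (n + 3)) * t d (n + 3) (n + 3) ^ a)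
          ∈ J d (n + 2) :=
        J_left _ (J_T a (bAt_incl_sub_mem_J _))
      have hX : incl d (n + 2) (incl d (n + 1) V * g d (n + 2) (n + 1) * incl d (n + 1) V')
          * (bAt d (n + 3) (n + 3) * t d (n + 3) (n + 3) ^ a)
          = incl d (n + 2) (incl d (n + 1) V) * (incl d (n + 2) (g d (n + 2) (n + 1))
            * (bAt d (n + 3) (n + 3) * t d (n + 3) (n + 3) ^ a))
            * incl d (n + 2) (incl d (n + 1) V')
          - incl d (n + 2) (incl d (n + 1) V * g d (n + 2) (n + 1))
          * ((bAt d (n + 3) (n + 3) * incl d (n + 2) (incl d (n + 1) V')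
            - incl d (n + 2) (incl d (n + 1) V') * bAt d (n + 3) (n + 3))
            * t d (n + 3) (n + 3) ^ a) := by
        have := T_pow_comm (d := d) a (incl d (n + 1) V')
        rw [sub_mul, mul_sub, mul_assoc (bAt _ _ _), ← this]
        simp only [map_mul, mul_assoc]
        abel
      rw [hX, sub_mul, mul_sub, map_sub, map_sub, ofJ hJ]
      congr 1
      have e1 : incl d (n + 2) (incl d (n + 1) V) * (incl d (n + 2) (g d (n + 2) (n + 1))
            * (bAt d (n + 3) (n + 3) * t d (n + 3) (n + 3) ^ a))
            * incl d (n + 2) (incl d (n + 1) V') * g d (n + 3) (n + 2)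
          = incl d (n + 2) (incl d (n + 1) V) * (incl d (n + 2) (g d (n + 2) (n + 1))
            * (bAt d (n + 3) (n + 3) * t d (n + 3) (n + 3) ^ a) * g d (n + 3) (n + 2)
            * incl d (n + 2) (incl d (n + 1) V')) := by
        rw [mul_assoc _ _ (g _ _ _), ← G_incl_comm]
        simp only [mul_assoc]
      have hgB : incl d (n + 2) (g d (n + 2) (n + 1)) * bAt d (n + 3) (n + 3)
          = bAt d (n + 3) (n + 3) * incl d (n + 2) (g d (n + 2) (n + 1)) := by
        rw [incl_g ⟨by omega, le_rfl⟩]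
        exact (g_bAt_of_gt (by omega) ⟨by omega, le_rfl⟩).eq
      have e2 : g d (n + 3) (n + 2) * (incl d (n + 2) (incl d (n + 1) V)
            * (incl d (n + 2) (g d (n + 2) (n + 1))
              * (bAt d (n + 3) (n + 3) * t d (n + 3) (n + 3) ^ a))
            * incl d (n + 2) (incl d (n + 1) V'))
          = incl d (n + 2) (incl d (n + 1) V) * (g d (n + 3) (n + 2) * bAt d (n + 3) (n + 3)
            * t d (n + 3) (n + 3) ^ a * incl d (n + 2) (g d (n + 2) (n + 1))
            * incl d (n + 2) (incl d (n + 1) V')) := by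
        rw [← mul_assoc (incl _ _ (g _ _ _)), hgB, mul_assoc (bAt _ _ _), ← T_pow_comm,
          mul_assoc (incl _ _ (incl _ _ V)), ← mul_assoc (g _ _ _), G_incl_comm]
        simp only [mul_assoc]
      rw [e1, e2]
      simp only [bigTr_succ _ _ (n := n + 2), bigTr_succ _ _ (n := n + 1), relTr_mul_left,
        relTr_mul_right, h1, relTr_GB, relTr_gbVal_G, map_smul]
      rw [← mul_assoc (g _ _ _), relTr_GB]
    | hadd A A' h h' => rw [map_add, add_mul, add_mul, mul_add, map_add, map_add, h, h']
  | hadd X X' h h' => rw [add_mul, mul_add, map_add, map_add, h, h']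

end Trace

/-! ### The trace property by induction along the tower -/

theorem map_mul_comm_of_generators {d n : ℕ} (Tr : Y d n →ₗ[𝕃] 𝕃)
    (hb : 1 ≤ n → ∀ X, Tr (X * b d n) = Tr (b d n * X))
    (hg : ∀ i, 1 ≤ i ∧ i + 1 ≤ n → ∀ X, Tr (X * g d n i) = Tr (g d n i * X))
    (ht : ∀ j, 1 ≤ j ∧ j ≤ n → ∀ X, Tr (X * t d n j) = Tr (t d n j * X)) (X X' : Y d n) :
    Tr (X * X') = Tr (X' * X) := by
  induction X' using adjoin_induction generalizing X with
  | hb h => exact hb h X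
  | hg i h => exact hg i h X
  | ht j h => exact ht j h X
  | hc c => rw [Algebra.commutes]
  | hadd p q hp hq => rw [mul_add, add_mul, map_add, map_add, hp, hq]
  | hmul p q hp hq => rw [← mul_assoc, hq, ← mul_assoc, hp, mul_assoc]

theorem eq_algebraMap_ground {d : ℕ} (W : Y d 0) : W = algebraMap 𝕃 _ (ground d W) :=
  (ground_bijective d).1 (by simp)

theorem commute_b_one {d : ℕ} (X : Y d 1) : Commute (b d 1) X := by
  have h0 (W : Y d 0) : Commute (b d 1) (incl d 0 W) := by
    rw [eq_algebraMap_ground W, AlgHom.commutes]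
    exact (Algebra.commutes _ _).symm
  have ht (a : ℕ) : Commute (b d 1) (t d 1 1 ^ a) :=
    ((t_b ⟨le_rfl, le_rfl⟩).pow_left a).symm
  induction X using succ_induction with
  | hT W a => exact (h0 W).mul_right (ht a)
  | hB W a => exact (h0 W).mul_right ((Commute.refl (b d 1)).mul_right (ht a))
  | hG h => omega
  | hadd X X' h h' => exact h.add_right h'

section Trace
variable {d : ℕ} [NeZero d] (x y : Fin d → 𝕃)

theorem bigTr_incl_comm {n : ℕ}
    (ih : ∀ X X', bigTr d (relTr x y) n (X * X') = bigTr d (relTr x y) n (X' * X))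
    (h : Y d n) (X : Y d (n + 1)) :
    bigTr d (relTr x y) (n + 1) (X * incl d n h) = bigTr d (relTr x y) (n + 1) (incl d n h * X) := by
  rw [bigTr_succ, relTr_mul_right, bigTr_succ, relTr_mul_left, ih]

theorem bigTr_t_last_comm {n : ℕ} (X : Y d (n + 1)) :
    bigTr d (relTr x y) (n + 1) (X * t d (n + 1) (n + 1))
      = bigTr d (relTr x y) (n + 1) (t d (n + 1) (n + 1) * X) := by
  rw [bigTr_succ, relTr_mul_T_comm, bigTr_succ]

theorem bigTr_comm (n : ℕ) (X X' : Y d n) :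
    bigTr d (relTr x y) n (X * X') = bigTr d (relTr x y) n (X' * X) := by
  -- Two consecutive levels are carried together because `bigTr_G` needs the trace property at both
  -- preceding levels.
  suffices h : (∀ X X' : Y d n, bigTr d (relTr x y) n (X * X') = bigTr d (relTr x y) n (X' * X)) ∧
      ∀ X X' : Y d (n + 1),
        bigTr d (relTr x y) (n + 1) (X * X') = bigTr d (relTr x y) (n + 1) (X' * X) from h.1 X X'
  clear X X'
  induction n with
  | zero =>
    refine ⟨fun X X' => ?_, map_mul_comm_of_generators _ (fun _ X => ?_) (fun i h => ?_) fun j h X => ?_⟩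
    · simp [bigTr, mul_comm]
    · rw [(commute_b_one X).eq]
    · omega
    · obtain rfl : j = 1 := by omega
      exact bigTr_t_last_comm x y X
  | succ n ih =>
    refine ⟨ih.2, map_mul_comm_of_generators _ (fun _ X => ?_) (fun i h X => ?_) fun j h X => ?_⟩
    · rw [← incl_b (by omega)]
      exact bigTr_incl_comm x y ih.2 _ X
    · rcases Nat.lt_or_ge i (n + 1) with hi | hi
      · rw [← incl_g ⟨h.1, by omega⟩]
        exact bigTr_incl_comm x y ih.2 _ X
      · obtain rfl : i = n + 1 := by omega
        exact bigTr_G x y ih.1 ih.2 X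
    · rcases Nat.lt_or_ge j (n + 2) with hj | hj
      · rw [← incl_t ⟨h.1, by omega⟩]
        exact bigTr_incl_comm x y ih.2 _ X
      · obtain rfl : j = n + 2 := by omega
        exact bigTr_t_last_comm x y X

/-! ### The Markov trace and its uniqueness -/

theorem per_zero (hx : x 0 = 1) : per x 0 = 1 := by
  rw [← hx, ← per_fin x 0, Fin.val_zero]

theorem bigTr_isMarkovTrace (hx : x 0 = 1) : IsMarkovTrace d x y (bigTr d (relTr x y)) where
  one n _ := by
    induction n with
    | zero => simp [bigTr]
    | succ n ih =>
      have h := relTr_T x y (n := n) 1 0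
      rw [map_one, pow_zero, mul_one, per_zero x hx, one_smul] at h
      rcases n with _ | n
      · rw [bigTr_succ, h]; simp [bigTr]
      · rw [bigTr_succ, h, ih (by omega)]
  mul_g n hn X := by
    obtain ⟨n, rfl⟩ : ∃ l, n = l + 1 := ⟨n - 1, by omega⟩
    have h := relTr_G x y X 1
    rw [map_one, mul_one, mul_one] at h
    rw [bigTr_succ x y (n := n + 1), h, map_smul, smul_eq_mul]
  mul_b_t n _ X m := by
    rw [mul_assoc, bigTr_succ, relTr_B, per_fin, map_smul, smul_eq_mul]
  mul_t n _ X m := by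
    rw [bigTr_succ, relTr_T, per_fin, map_smul, smul_eq_mul]
  comm n _ := bigTr_comm x y n

section Unique
variable {x y} {Tr Tr' : (n : ℕ) → Y d n →ₗ[𝕃] 𝕃}

theorem IsMarkovTrace.apply_T (h : IsMarkovTrace d x y Tr) {n : ℕ} (hn : 1 ≤ n) (X : Y d n) (a : ℕ) :
    Tr (n + 1) (incl d n X * t d (n + 1) (n + 1) ^ a) = per x a * Tr n X := by
  rw [← t_pow_mod ⟨by omega, le_rfl⟩]
  exact h.mul_t n hn X ⟨a % d, Nat.mod_lt _ (NeZero.pos d)⟩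

theorem IsMarkovTrace.apply_B (h : IsMarkovTrace d x y Tr) {n : ℕ} (hn : 1 ≤ n) (X : Y d n) (a : ℕ) :
    Tr (n + 1) (incl d n X * (bAt d (n + 1) (n + 1) * t d (n + 1) (n + 1) ^ a))
      = per y a * Tr n X := by
  rw [← t_pow_mod ⟨by omega, le_rfl⟩, ← mul_assoc]
  exact h.mul_b_t n hn X ⟨a % d, Nat.mod_lt _ (NeZero.pos d)⟩

/-- The framing rule with exponent `0` and `x 0 = 1` makes `Tr_{n+2}` extend `Tr_{n+1}`, and
cyclicity allows the conjugation. This turns elements of the lower algebra into ones covered by the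
Markov rules. -/
theorem IsMarkovTrace.apply_eq_conj (h : IsMarkovTrace d x y Tr) (hx : x 0 = 1) {n : ℕ}
    (Z : Y d (n + 1)) : Tr (n + 1) Z
      = Tr (n + 2) (g d (n + 2) (n + 1) * incl d (n + 1) Z * gInv d (n + 2) (n + 1)) := by
  have h1 := h.apply_T (by omega) Z 0
  rw [pow_zero, mul_one, per_zero x hx, one_mul] at h1
  rw [← h1, h.comm (n + 2) (by omega) _ (gInv _ _ _), ← mul_assoc, inv_mul_G, one_mul]

theorem IsMarkovTrace.unique (h : IsMarkovTrace d x y Tr) (h' : IsMarkovTrace d x y Tr')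
    (hx : x 0 = 1) {n : ℕ} (hn : 1 ≤ n) : Tr' n = Tr n := by
  induction n, hn using Nat.le_induction with
  | base =>
    -- Apart from `Tr_1(1) = 1`, the rules assign values only from level 2 on. The values on `t₁^a`
    -- and `b₁ t₁^a` come from `Tr_2` at their conjugates `t₂^a` and `b₂ t₂^a`.
    have val {Tr : (n : ℕ) → Y d n →ₗ[𝕃] 𝕃} (h : IsMarkovTrace d x y Tr) (W : Y d 0) (a : ℕ) :
        Tr 1 (incl d 0 W * t d 1 1 ^ a) = ground d W * per x a ∧
        Tr 1 (incl d 0 W * (bAt d 1 1 * t d 1 1 ^ a)) = ground d W * per y a := by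
      have hT := h.apply_T le_rfl 1 a
      have hB := h.apply_B le_rfl 1 a
      rw [h.one 1 le_rfl, mul_one, map_one, one_mul] at hT hB
      constructor
      · rw [eq_algebraMap_ground W, AlgHom.commutes, ← Algebra.smul_def, map_smul,
          h.apply_eq_conj hx, G_T_inv, hT, smul_eq_mul]
        simp
      · rw [eq_algebraMap_ground W, AlgHom.commutes, ← Algebra.smul_def, map_smul,
          h.apply_eq_conj hx, G_BT_inv, hB, smul_eq_mul]
        simp
    ext X
    induction X using succ_induction with
    | hT W a => rw [(val h W a).1, (val h' W a).1]
    | hB W a => rw [(val h W a).2, (val h' W a).2]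
    | hG hn => omega
    | hadd X X' h h' => rw [map_add, map_add, h, h']
  | succ n hn ih =>
    -- Cyclicity brings `C` to the front, so that the rule for a trailing `g` applies.
    have hG {Tr : (n : ℕ) → Y d n →ₗ[𝕃] 𝕃} (h : IsMarkovTrace d x y Tr) (A C : Y d n) :
        Tr (n + 1) (incl d n A * g d (n + 1) n * incl d n C) = pz * Tr n (C * A) := by
      rw [h.comm (n + 1) (by omega), ← mul_assoc, ← map_mul, h.mul_g n hn]
    ext X
    induction X using succ_induction with
    | hT W a => rw [h.apply_T hn, h'.apply_T hn, ih]
    | hB W a => rw [h.apply_B hn, h'.apply_B hn, ih]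
    | hG _ A C => rw [hG h, hG h', ih]
    | hadd X X' h h' => rw [map_add, map_add, h, h']

end Unique
end Trace
end FramedB
end

theorem theorem5p7 (d : ℕ) [NeZero d] (x y : Fin d → FramedB.𝕃) (hx : x 0 = 1) :
    (∀ n : ℕ, LinearIndepOn FramedB.𝕃 id (FramedB.C d n) ∧
      Submodule.span FramedB.𝕃 (FramedB.C d n) = ⊤) ∧
    ∃ tr : (n : ℕ) → FramedB.Y d (n + 1) →ₗ[FramedB.𝕃] FramedB.Y d n,
      FramedB.IsRelTrace d x y tr ∧
      (∀ tr' : (n : ℕ) → FramedB.Y d (n + 1) →ₗ[FramedB.𝕃] FramedB.Y d n,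
        FramedB.IsRelTrace d x y tr' → tr' = tr) ∧
      FramedB.IsMarkovTrace d x y (FramedB.bigTr d tr) ∧
      (∀ Tr' : (n : ℕ) → FramedB.Y d n →ₗ[FramedB.𝕃] FramedB.𝕃,
        FramedB.IsMarkovTrace d x y Tr' → ∀ n : ℕ, 1 ≤ n → Tr' n = FramedB.bigTr d tr n) := by
  refine ⟨fun n => ⟨FramedB.linearIndepOn_C d n, FramedB.span_C d n⟩, FramedB.relTr x y,
    FramedB.relTr_isRelTrace x y, fun tr' h => (FramedB.relTr_isRelTrace x y).unique h,
    FramedB.bigTr_isMarkovTrace x y hx, fun Tr' h n hn =>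
      (FramedB.bigTr_isMarkovTrace x y hx).unique h hx hn⟩
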